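/- Let $0<\bar\theta<\pi/2$, $\alpha>1$, $x_2(0)<0$, $\dot x_1(0)>0$, $\dot x_2(0)>0$. In $\mathbb R^2$ put $y_1(x)=x_1\cos\bar\theta+x_2\sin\bar\theta$, $y_2(x)=-x_1\sin\bar\theta+x_2\cos\bar\theta$, and $$K=\{x: x_1\le 0,\ y_1(x)\le 0\},\qquad \mathcal R_2=\{x: x_2\ge 0,\ y_2(x)\le 0\},\qquad \mathcal R_3=\{x: y_1(x)\ge 0,\ y_2(x)\ge 0\}.$$ Let $P_K$ be the orthogonal (closest point) projection onto $K$, and let $G(u,v)=\dfrac{(v\cdot(u-P_Ku))\,(u-P_Ku)}{|u-P_Ku|^2}$ if $u\notin K$, $G(u,v)=0$ if $u\in K$. For $k>0$ consider on $[0,\infty)$ the problem $$\ddot u_k+2\alpha\sqrt k\,G(u_k,\dot u_k)+k(u_k-P_Ku_k)=0,\qquad u_k(0)=(0,x_2(0)),\quad \dot u_k(0)=(\dot x_1(0),\dot x_2(0)),\qquad(\ast)$$ where a solution is a continuously differentiable $u_k$ whose velocity satisfies the time-integrated equation. Put $$\Delta=\alpha^2-1,\quad \xi_1=-\alpha+\sqrt\Delta,\quad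 t_0=-\frac{x_2(0)}{\dot x_2(0)},\quad \eta=e^{\xi_1t_0\sqrt k/2},\quad E=\frac{\dot x_1(0)^2\dot x_2(0)^2}{4\Delta},$$ let $R(\tau)=\sqrt k\,\bigl|u_k(t_0+\tau/\sqrt k)\bigr|/\eta$ be the rescaled radius, and let $W=\dot R(0)^2+E/R(0)^2$. Then $(\ast)$ has a solution for all large enough $k$. Moreover there is a constant $C$, depending only on $\bar\theta,\alpha,x_2(0),\dot x_1(0),\dot x_2(0)$, such that for every family $(u_k)$ in which $u_k$ solves $(\ast)$ for all large enough $k$, there are numbers $\bar\tau=\bar\tau(k)$ such that, with $\bar t=t_0+\bar\tau/\sqrt k$, the following holds. (i) For all large enough $k$ and all $t\ge0$: $u_k(t)\in\mathcal R_2$ if and only if $t_0\le t\le\bar t$, and $u_k(t)\in\mathcal R_3$ if and only if $t\ge\bar t$. (ii) As $k\to\infty$, $\bar\tau\sim\tan\bar\theta\,\sqrt E/W$ and $\bar\tau=O(\eta^2)$. (iii) For all large enough $k$ and all $t\ge\bar t$: $0\le y_1(u_k(t))\le C\,e^{\xi_1(t-\bar t)\sqrt k}/\sqrt k$. (iv)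 As $k\to\infty$, $y_2(u_k(t))\sim(t-\bar t)\,\dot x_2(0)\cos\bar\theta$ uniformly in $t\ge\bar t$: for every $\epsilon>0$, for all large enough $k$ and all $t\ge\bar t$, $\bigl|y_2(u_k(t))-(t-\bar t)\dot x_2(0)\cos\bar\theta\bigr|\le\epsilon\,(t-\bar t)\dot x_2(0)\cos\bar\theta$. -/

import Mathlib

open Real Set Filter Topology MeasureTheory Asymptotics

noncomputable section

/-- The Euclidean plane. -/
abbrev Plane : Type := EuclideanSpace ℝ (Fin 2)

/-- First rotated coordinate, along the outer normal of the second side of the cone. -/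
def coordY₁ (θ : ℝ) (x : Plane) : ℝ := x 0 * cos θ + x 1 * sin θ

/-- Second rotated coordinate, along the second side of the cone. -/
def coordY₂ (θ : ℝ) (x : Plane) : ℝ := -(x 0) * sin θ + x 1 * cos θ

/-- The angular domain. -/
def coneK (θ : ℝ) : Set Plane := {x | x 0 ≤ 0 ∧ coordY₁ θ x ≤ 0}

/-- The region of the plane in which the closest point of the cone is the vertex. -/
def region₂ (θ : ℝ) : Set Plane := {x | 0 ≤ x 1 ∧ coordY₂ θ x ≤ 0}

/-- The region of the plane in which the closest point of the cone is on its second side. -/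
def region₃ (θ : ℝ) : Set Plane := {x | 0 ≤ coordY₁ θ x ∧ 0 ≤ coordY₂ θ x}

theorem exists_closest_point_coneK (θ : ℝ) (x : Plane) :
    ∃ p ∈ coneK θ, ∀ z ∈ coneK θ, dist x p ≤ dist x z := by
  have hc : IsClosed (coneK θ) := by
    have h : Continuous fun x : Plane => coordY₁ θ x := by unfold coordY₁; fun_prop
    have h0 : Continuous fun x : Plane => x 0 := by fun_prop
    exact (isClosed_le h0 continuous_const).inter (isClosed_le h continuous_const)
  have hne : (coneK θ).Nonempty := ⟨0, by simp [coneK, coordY₁]⟩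
  obtain ⟨p, hp, h⟩ := hc.exists_infDist_eq_dist hne x
  exact ⟨p, hp, fun z hz => h ▸ Metric.infDist_le_dist_of_mem hz⟩

/-- The projection onto the cone: the point of the (closed, convex) cone closest to `x`. -/
def projK (θ : ℝ) (x : Plane) : Plane := (exists_closest_point_coneK θ x).choose

open Classical in
/-- The damping direction `G(u, v)`: the component of the velocity along `u - P_K u`. -/
def dampG (θ : ℝ) (u v : Plane) : Plane :=
  if u ∈ coneK θ then 0
  else (inner ℝ v (u - projK θ u) / ‖u - projK θ u‖ ^ 2) • (u - projK θ u)

/-- The force `2 α √k G(u, v) + k (u - P_K u)` of the penalized equation. -/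
def penaltyForce (θ α k : ℝ) (u v : Plane) : Plane :=
  (2 * α * √k) • dampG θ u v + k • (u - projK θ u)

/-- `u` is a solution on `[0, ∞)` of `u'' + 2 α √k G(u, u') + k (u - P_K u) = 0` with
`u(0) = (0, x₂₀)` and `u'(0) = (v₁₀, v₂₀)`. Since `G` is discontinuous across the boundary of
the cone (where the motion starts), the equation is understood in the sense of Carathéodory:
`u` is continuously differentiable and its velocity `v` satisfies the integrated equation. -/
def IsPenalizedMotion (θ α x₂₀ v₁₀ v₂₀ k : ℝ) (u : ℝ → Plane) : Prop :=
  u 0 = !₂[0, x₂₀] ∧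
  ∃ v : ℝ → Plane,
    ContinuousOn v (Ici 0) ∧
    (∀ t, 0 ≤ t → HasDerivWithinAt u (v t) (Ici 0) t) ∧
    ∀ t, 0 ≤ t →
      IntervalIntegrable (fun s => penaltyForce θ α k (u s) (v s)) volume 0 t ∧
      v t = !₂[v₁₀, v₂₀] - ∫ s in (0 : ℝ)..t, penaltyForce θ α k (u s) (v s)

/-- The larger root of `ξ² + 2 α ξ + 1 = 0`. -/
def xi₁ (α : ℝ) : ℝ := -α + √(α ^ 2 - 1)

/-- The time at which the free tangential motion along the first side reaches the corner. -/
def cornerTime (x₂₀ v₂₀ : ℝ) : ℝ := -x₂₀ / v₂₀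

/-- The small scale `η`. -/
def etaScale (α x₂₀ v₂₀ k : ℝ) : ℝ := exp (xi₁ α * cornerTime x₂₀ v₂₀ * √k / 2)

/-- The constant `E`. -/
def constE (α v₁₀ v₂₀ : ℝ) : ℝ := v₁₀ ^ 2 * v₂₀ ^ 2 / (4 * (α ^ 2 - 1))

/-- The scaled radius `R(τ)`, given by `|u(t)| = η R(τ) / √k` with `t = t₀ + τ / √k`. -/
def scaledRadius (α x₂₀ v₂₀ k : ℝ) (u : ℝ → Plane) (τ : ℝ) : ℝ :=
  √k * ‖u (cornerTime x₂₀ v₂₀ + τ / √k)‖ / etaScale α x₂₀ v₂₀ k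

/-- The quantity `W = R'(0)² + E / R(0)²`. -/
def energyW (α x₂₀ v₁₀ v₂₀ k : ℝ) (u : ℝ → Plane) : ℝ :=
  deriv (scaledRadius α x₂₀ v₂₀ k u) 0 ^ 2
    + constE α v₁₀ v₂₀ / scaledRadius α x₂₀ v₂₀ k u 0 ^ 2

end

noncomputable section

/-! ### The geometry of the cone -/

/-! Next to a straight side the penalized equation decouples: tangentially the motion is free, and
along the normal it is an overdamped oscillator with exponents `xi₁ α` and `xi₂ α`. Up to the corner
time t₀ the motion is therefore explicit. At t₀ it sits at (X, 0) with velocity (D, v₂₀), where √k X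
~ c η² with c = v₁₀/(ξ₁ - ξ₂), and D = O(η²).

In the vertex region the equation is nonlinear, but it need not be solved. The force has norm at
most 2α√k|v| + k|u|, and the crossing takes a time of order X, which is exponentially short compared
to 1/√k. Hence the velocity stays within `velErr` → 0 of (0, v₂₀) and the path is nearly a vertical
segment. It crosses the ray y₂ = 0 exactly once, at a time T with T - t₀ ~ X tan θ / v₂₀, and keeps
x₁ ≥ X/2 meanwhile (`norm_vel_sub_le`, `exists_isCrossing`). It enters the third region with y₁, y₁'
and y₂' positive. From there the motion is again explicit: y₂ grows linearly with slope y₂'(T) close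
to v₂₀ cos θ, and y₁ is an oscillator that stays positive and is dominated by its slow mode.

For (ii), R(0) = √k X/η ~ cη and R'(0) = D/η, so E/R(0)² dominates W. Since √E = c v₂₀, W η² → v₂₀²,
and both τbar and tan θ √E/W, divided by η², tend to c tan θ / v₂₀.

Uniqueness is used only near the sides, where the field is linear (`IsPhaseMotion.eqOn_sidePos`); in
the vertex region the force bound alone controls every solution (`IsStiff.passage`). Existence is
obtained by gluing the two explicit pieces to a Picard–Lindelöf solution of a regularized vertex
field. -/

/-- The unit vector at angle `φ` from the first axis. -/
def unitVec (φ : ℝ) : Plane := !₂[cos φ, sin φ]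

theorem inner_plane (x y : Plane) : inner ℝ x y = x 0 * y 0 + x 1 * y 1 := by
  simp [PiLp.inner_apply, Fin.sum_univ_two, mul_comm]

theorem normSq_plane (x : Plane) : ‖x‖ ^ 2 = x 0 ^ 2 + x 1 ^ 2 := by
  rw [← real_inner_self_eq_norm_sq, inner_plane]; ring

theorem inner_unitVec (φ : ℝ) (x : Plane) : inner ℝ x (unitVec φ) = coordY₁ φ x := by
  simp [inner_plane, unitVec, coordY₁]

theorem norm_unitVec (φ : ℝ) : ‖unitVec φ‖ = 1 := by
  have h := normSq_plane (unitVec φ)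
  simp only [unitVec, PiLp.toLp_apply, Matrix.cons_val_zero, Matrix.cons_val_one] at h
  rw [cos_sq_add_sin_sq] at h
  have := norm_nonneg (unitVec φ)
  unfold unitVec at *
  nlinarith

@[simp] theorem coordY₁_zero_angle (x : Plane) : coordY₁ 0 x = x 0 := by simp [coordY₁]

@[simp] theorem coordY₂_zero_angle (x : Plane) : coordY₂ 0 x = x 1 := by simp [coordY₂]

theorem coordY₁_add (φ : ℝ) (x y : Plane) : coordY₁ φ (x + y) = coordY₁ φ x + coordY₁ φ y := by
  simp [coordY₁]; ring

theorem coordY₂_add (φ : ℝ) (x y : Plane) : coordY₂ φ (x + y) = coordY₂ φ x + coordY₂ φ y := by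
  simp [coordY₂]; ring

theorem coordY₁_smul (φ c : ℝ) (x : Plane) : coordY₁ φ (c • x) = c * coordY₁ φ x := by
  simp [coordY₁]; ring

theorem coordY₂_smul (φ c : ℝ) (x : Plane) : coordY₂ φ (c • x) = c * coordY₂ φ x := by
  simp [coordY₂]; ring

@[simp] theorem coordY₁_unitVec (φ : ℝ) : coordY₁ φ (unitVec φ) = 1 := by
  simp [coordY₁, unitVec, ← sq]

@[simp] theorem coordY₂_unitVec (φ : ℝ) : coordY₂ φ (unitVec φ) = 0 := by
  simp [coordY₂, unitVec]; ring

theorem sq_coordY_add_sq (φ : ℝ) (x : Plane) :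
    coordY₁ φ x ^ 2 + coordY₂ φ x ^ 2 = ‖x‖ ^ 2 := by
  rw [normSq_plane]; simp only [coordY₁, coordY₂]
  linear_combination (x 0 ^ 2 + x 1 ^ 2) * (sin_sq_add_cos_sq φ)

theorem abs_coordY₁_le (φ : ℝ) (x : Plane) : |coordY₁ φ x| ≤ ‖x‖ := by
  apply abs_le_of_sq_le_sq _ (norm_nonneg x)
  nlinarith [sq_coordY_add_sq φ x, sq_nonneg (coordY₂ φ x)]

theorem abs_coordY₂_le (φ : ℝ) (x : Plane) : |coordY₂ φ x| ≤ ‖x‖ := by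
  apply abs_le_of_sq_le_sq _ (norm_nonneg x)
  nlinarith [sq_coordY_add_sq φ x, sq_nonneg (coordY₁ φ x)]

/-- The coordinate `coordY₁` as a continuous linear map. -/
def coordY₁L (φ : ℝ) : Plane →L[ℝ] ℝ :=
  LinearMap.mkContinuous ⟨⟨coordY₁ φ, coordY₁_add φ⟩, coordY₁_smul φ⟩ 1
    fun x => by simpa using abs_coordY₁_le φ x

/-- The coordinate `coordY₂` as a continuous linear map. -/
def coordY₂L (φ : ℝ) : Plane →L[ℝ] ℝ :=
  LinearMap.mkContinuous ⟨⟨coordY₂ φ, coordY₂_add φ⟩, coordY₂_smul φ⟩ 1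
    fun x => by simpa using abs_coordY₂_le φ x

theorem continuous_coordY₁ (φ : ℝ) : Continuous (coordY₁ φ) := (coordY₁L φ).continuous

theorem continuous_coordY₂ (φ : ℝ) : Continuous (coordY₂ φ) := (coordY₂L φ).continuous

theorem HasDerivWithinAt.coordY₁ {φ : ℝ} {u : ℝ → Plane} {v : Plane} {s : Set ℝ} {t : ℝ}
    (h : HasDerivWithinAt u v s t) :
    HasDerivWithinAt (fun t => coordY₁ φ (u t)) (coordY₁ φ v) s t :=
  (coordY₁L φ).hasFDerivAt.comp_hasDerivWithinAt t h

theorem HasDerivWithinAt.coordY₂ {φ : ℝ} {u : ℝ → Plane} {v : Plane} {s : Set ℝ} {t : ℝ}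
    (h : HasDerivWithinAt u v s t) :
    HasDerivWithinAt (fun t => coordY₂ φ (u t)) (coordY₂ φ v) s t :=
  (coordY₂L φ).hasFDerivAt.comp_hasDerivWithinAt t h

theorem zero_mem_coneK (θ : ℝ) : (0 : Plane) ∈ coneK θ := by simp [coneK, coordY₁]

/-- A point of the cone at which the obtuse angle criterion holds is the projection. -/
theorem projK_eq_of_inner_nonpos {θ : ℝ} {u q : Plane} (hq : q ∈ coneK θ)
    (h : ∀ z ∈ coneK θ, inner ℝ (u - q) (z - q) ≤ 0) : projK θ u = q := by
  obtain ⟨hp, hmin⟩ := (exists_closest_point_coneK θ u).choose_spec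
  change projK θ u ∈ _ at hp
  change ∀ z ∈ coneK θ, dist u (projK θ u) ≤ dist u z at hmin
  have h1 := hmin q hq
  have h2 := h _ hp
  rw [dist_eq_norm, dist_eq_norm] at h1
  have h3 : ‖u - projK θ u‖ ^ 2
      = ‖u - q‖ ^ 2 - 2 * inner ℝ (u - q) (projK θ u - q) + ‖projK θ u - q‖ ^ 2 := by
    rw [← norm_sub_sq_real]; congr 2; abel
  have h4 : ‖u - projK θ u‖ ^ 2 ≤ ‖u - q‖ ^ 2 := by gcongr
  have h5 : ‖projK θ u - q‖ ^ 2 ≤ 0 := by linarith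
  have h6 : ‖projK θ u - q‖ = 0 := by
    have := sq_nonneg ‖projK θ u - q‖
    exact pow_eq_zero_iff two_ne_zero |>.1 (le_antisymm h5 this)
  exact sub_eq_zero.1 (norm_eq_zero.1 h6)

theorem sub_projK_of_first_region {θ : ℝ} (hθ₀ : 0 ≤ sin θ) {u : Plane} (h0 : 0 ≤ u 0)
    (h1 : u 1 ≤ 0) : u - projK θ u = coordY₁ 0 u • unitVec 0 := by
  have : projK θ u = !₂[0, u 1] := by
    apply projK_eq_of_inner_nonpos
    · simp only [coneK, coordY₁, mem_ofPred_eq, Matrix.cons_val_zero, Matrix.cons_val_one, le_refl,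
        true_and]
      nlinarith
    · rintro z ⟨hz, -⟩
      simp [inner_plane]
      nlinarith
  rw [this]
  ext i; fin_cases i <;> simp [unitVec]

theorem sub_projK_of_mem_region₃ {θ : ℝ} (hθ₀ : 0 ≤ sin θ) {u : Plane} (hu : u ∈ region₃ θ) :
    u - projK θ u = coordY₁ θ u • unitVec θ := by
  have hq : projK θ u = u - coordY₁ θ u • unitVec θ := by
    apply projK_eq_of_inner_nonpos
    · have h2 := hu.2
      refine ⟨?_, ?_⟩
      · have : (u - coordY₁ θ u • unitVec θ) 0 = - (coordY₂ θ u * sin θ) := by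
          simp [coordY₁, coordY₂, unitVec]
          linear_combination (-u 0) * (sin_sq_add_cos_sq θ)
        rw [this]
        have := mul_nonneg h2 hθ₀
        linarith
      · rw [sub_eq_add_neg, ← neg_smul, coordY₁_add, coordY₁_smul]; simp
    · rintro z ⟨-, hz⟩
      have h1 := hu.1
      rw [sub_sub_cancel, real_inner_smul_left, real_inner_comm, inner_unitVec, sub_sub_eq_add_sub,
        sub_eq_add_neg, coordY₁_add, coordY₁_add, coordY₁_smul, ← neg_one_smul ℝ, coordY₁_smul]
      simp
      nlinarith
  rw [hq, sub_sub_cancel]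

/-- The region is the polar cone of `coneK θ`: up to the factor sin θ, the numbers u₁ and -y₂(u) are
the coordinates of u in the basis of the two outer normals. The identity `key` is this
decomposition. -/
theorem projK_of_mem_region₂ {θ : ℝ} (hθ₀ : 0 < sin θ) {u : Plane}
    (hu : u ∈ region₂ θ) : projK θ u = 0 := by
  apply projK_eq_of_inner_nonpos (zero_mem_coneK θ)
  rintro z ⟨hz0, hz1⟩
  obtain ⟨h1, h2⟩ := hu
  have key : sin θ * inner ℝ u z = u 1 * coordY₁ θ z + (-coordY₂ θ u) * z 0 := by
    rw [inner_plane]; simp only [coordY₁, coordY₂]; ring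
  have : sin θ * inner ℝ u z ≤ 0 := by
    rw [key]
    have := mul_nonpos_of_nonneg_of_nonpos h1 hz1
    have := mul_nonpos_of_nonneg_of_nonpos (neg_nonneg.2 h2) hz0
    linarith
  simpa using nonpos_of_mul_nonpos_right this hθ₀

/-! ### Explicit forms of the penalty force and its growth bound -/

/-- The force exerted by a straight side with outer normal `unitVec φ`. -/
def sideForce (φ α k : ℝ) (u v : Plane) : Plane :=
  (2 * α * √k * coordY₁ φ v + k * coordY₁ φ u) • unitVec φ

/-- The force exerted by the vertex. -/
def vertexForce (α k : ℝ) (u v : Plane) : Plane :=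
  (2 * α * √k) • ((inner ℝ v u / ‖u‖ ^ 2) • u) + k • u

/-- When u - P_K u is a positive multiple of a fixed unit normal, the multiple cancels in G, which
becomes linear in the velocity. -/
theorem penaltyForce_eq_sideForce {θ φ α k : ℝ} {u v : Plane} (hu : u ∉ coneK θ)
    (h0 : 0 < coordY₁ φ u) (h : u - projK θ u = coordY₁ φ u • unitVec φ) :
    penaltyForce θ α k u v = sideForce φ α k u v := by
  simp only [penaltyForce, dampG, hu, if_false, h, sideForce]
  rw [norm_smul, norm_unitVec, real_inner_smul_right, inner_unitVec, mul_one, norm_eq_abs, sq_abs,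
    smul_smul, smul_smul, smul_smul, ← add_smul]
  congr 1
  field_simp

theorem penaltyForce_of_first_region {θ α k : ℝ} (hθ₀ : 0 ≤ sin θ) {u v : Plane} (h0 : 0 < u 0)
    (h1 : u 1 ≤ 0) : penaltyForce θ α k u v = sideForce 0 α k u v :=
  penaltyForce_eq_sideForce (fun h => h0.not_ge h.1) (by simpa using h0)
    (sub_projK_of_first_region hθ₀ h0.le h1)

theorem penaltyForce_of_mem_region₃ {θ α k : ℝ} (hθ₀ : 0 ≤ sin θ) {u v : Plane}
    (h1 : 0 < coordY₁ θ u) (h2 : 0 ≤ coordY₂ θ u) :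
    penaltyForce θ α k u v = sideForce θ α k u v :=
  penaltyForce_eq_sideForce (fun h => h1.not_ge h.2) h1
    (sub_projK_of_mem_region₃ hθ₀ ⟨h1.le, h2⟩)

theorem penaltyForce_of_mem_region₂ {θ α k : ℝ} (hθ₀ : 0 < sin θ) {u v : Plane} (h0 : 0 < u 0)
    (hu : u ∈ region₂ θ) : penaltyForce θ α k u v = vertexForce α k u v := by
  have hK : u ∉ coneK θ := fun h => h0.not_ge h.1
  simp [penaltyForce, dampG, hK, projK_of_mem_region₂ hθ₀ hu, vertexForce]

theorem norm_inner_div_smul_le (v q : Plane) : ‖(inner ℝ v q / ‖q‖ ^ 2) • q‖ ≤ ‖v‖ := by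
  rcases eq_or_ne q 0 with rfl | hq
  · simp
  · have hq' : 0 < ‖q‖ := norm_pos_iff.2 hq
    rw [norm_smul, norm_div, norm_pow, norm_norm]
    calc ‖inner ℝ v q‖ / ‖q‖ ^ 2 * ‖q‖ ≤ (‖v‖ * ‖q‖) / ‖q‖ ^ 2 * ‖q‖ := by
          gcongr; exact norm_inner_le_norm v q
      _ = ‖v‖ := by field_simp

/-- G is an orthogonal projection of the velocity, and the vertex competes in the definition of the
closest point. This is all that the analysis of arbitrary solutions in the vertex region needs to
know about the force. -/
theorem norm_penaltyForce_le {θ α k : ℝ} (hα : 0 ≤ α) (hk : 0 ≤ k) (u v : Plane) :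
    ‖penaltyForce θ α k u v‖ ≤ 2 * α * √k * ‖v‖ + k * ‖u‖ := by
  have h1 : ‖dampG θ u v‖ ≤ ‖v‖ := by
    unfold dampG; split_ifs
    · simp
    · exact norm_inner_div_smul_le _ _
  have h2 : ‖u - projK θ u‖ ≤ ‖u‖ := by
    have h : dist u (projK θ u) ≤ dist u 0 :=
      (exists_closest_point_coneK θ u).choose_spec.2 0 (zero_mem_coneK θ)
    simpa [dist_eq_norm] using h
  refine (norm_add_le _ _).trans ?_
  rw [norm_smul, norm_smul, norm_of_nonneg hk, norm_of_nonneg (by positivity)]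
  gcongr

/-! ### Motion along a straight side -/

/-- The smaller root of `ξ² + 2 α ξ + 1 = 0`. -/
def xi₂ (α : ℝ) : ℝ := -α - √(α ^ 2 - 1)

theorem sqrt_disc_pos {α : ℝ} (hα : 1 < α) : 0 < √(α ^ 2 - 1) :=
  sqrt_pos.2 (by nlinarith)

theorem xi₁_sub_xi₂ (α : ℝ) : xi₁ α - xi₂ α = 2 * √(α ^ 2 - 1) := by
  unfold xi₁ xi₂; ring

theorem xi₂_lt_xi₁ {α : ℝ} (hα : 1 < α) : xi₂ α < xi₁ α := by
  have := sqrt_disc_pos hα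
  unfold xi₁ xi₂; linarith

theorem xi₁_neg {α : ℝ} (hα : 1 < α) : xi₁ α < 0 := by
  have : √(α ^ 2 - 1) < α := by
    rw [sqrt_lt' (by linarith)]; linarith
  unfold xi₁; linarith

theorem xi₂_neg {α : ℝ} (hα : 1 < α) : xi₂ α < 0 := (xi₂_lt_xi₁ hα).trans (xi₁_neg hα)

theorem xi₁_sq {α : ℝ} (hα : 1 < α) : xi₁ α ^ 2 = -(2 * α * xi₁ α) - 1 := by
  have : √(α ^ 2 - 1) ^ 2 = α ^ 2 - 1 := sq_sqrt (by nlinarith)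
  unfold xi₁; linear_combination this

theorem xi₂_sq {α : ℝ} (hα : 1 < α) : xi₂ α ^ 2 = -(2 * α * xi₂ α) - 1 := by
  have : √(α ^ 2 - 1) ^ 2 = α ^ 2 - 1 := sq_sqrt (by nlinarith)
  unfold xi₂; linear_combination this

/-- The coefficient of the slow mode of the overdamped oscillator started at `p` with velocity
`q`. -/
def slowAmp (α k p q : ℝ) : ℝ := (q / √k - xi₂ α * p) / (xi₁ α - xi₂ α)

/-- The coefficient of the fast mode of the overdamped oscillator started at `p` with velocity
`q`. -/
def fastAmp (α k p q : ℝ) : ℝ := (xi₁ α * p - q / √k) / (xi₁ α - xi₂ α)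

/-- The position of the oscillator `x'' + 2 α √k x' + k x = 0` started at `p` with velocity `q`. -/
def oscPos (α k p q t : ℝ) : ℝ :=
  slowAmp α k p q * exp (xi₁ α * t * √k) + fastAmp α k p q * exp (xi₂ α * t * √k)

/-- The velocity of the oscillator `x'' + 2 α √k x' + k x = 0` started at `p` with velocity `q`. -/
def oscVel (α k p q t : ℝ) : ℝ :=
  √k * (xi₁ α * slowAmp α k p q * exp (xi₁ α * t * √k)
    + xi₂ α * fastAmp α k p q * exp (xi₂ α * t * √k))

theorem hasDerivAt_exp_mode (ξ c t : ℝ) :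
    HasDerivAt (fun t => exp (ξ * t * c)) (exp (ξ * t * c) * (ξ * c)) t := by
  have h : HasDerivAt (fun t => ξ * t * c) (ξ * 1 * c) t :=
    ((hasDerivAt_id t).const_mul ξ).mul_const c
  simpa using h.exp

theorem hasDerivAt_oscPos (α k p q t : ℝ) :
    HasDerivAt (oscPos α k p q) (oscVel α k p q t) t := by
  have h := ((hasDerivAt_exp_mode (xi₁ α) √k t).const_mul (slowAmp α k p q)).add
    ((hasDerivAt_exp_mode (xi₂ α) √k t).const_mul (fastAmp α k p q))
  refine h.congr_deriv ?_
  unfold oscVel; ring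

theorem hasDerivAt_oscVel {α k : ℝ} (hα : 1 < α) (hk : 0 < k) (p q t : ℝ) :
    HasDerivAt (oscVel α k p q)
      (-(2 * α * √k * oscVel α k p q t + k * oscPos α k p q t)) t := by
  have h := (((hasDerivAt_exp_mode (xi₁ α) √k t).const_mul (xi₁ α * slowAmp α k p q)).add
    ((hasDerivAt_exp_mode (xi₂ α) √k t).const_mul (xi₂ α * fastAmp α k p q))).const_mul √k
  refine h.congr_deriv ?_
  have hs : √k ^ 2 = k := sq_sqrt hk.le
  unfold oscVel oscPos
  linear_combination (√k ^ 2 * slowAmp α k p q * exp (xi₁ α * t * √k)) * xi₁_sq hα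
    + (√k ^ 2 * fastAmp α k p q * exp (xi₂ α * t * √k)) * xi₂_sq hα
    - (slowAmp α k p q * exp (xi₁ α * t * √k) + fastAmp α k p q * exp (xi₂ α * t * √k)) * hs

theorem slowAmp_add_fastAmp {α : ℝ} (hα : 1 < α) (k p q : ℝ) :
    slowAmp α k p q + fastAmp α k p q = p := by
  have : xi₁ α - xi₂ α ≠ 0 := (sub_pos.2 (xi₂_lt_xi₁ hα)).ne'
  unfold slowAmp fastAmp; field_simp; ring

@[simp] theorem oscPos_zero {α : ℝ} (hα : 1 < α) (k p q : ℝ) : oscPos α k p q 0 = p := by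
  simp [oscPos, slowAmp_add_fastAmp hα]

@[simp] theorem oscVel_zero {α k : ℝ} (hα : 1 < α) (hk : 0 < k) (p q : ℝ) :
    oscVel α k p q 0 = q := by
  have : xi₁ α - xi₂ α ≠ 0 := (sub_pos.2 (xi₂_lt_xi₁ hα)).ne'
  have : √k ≠ 0 := (sqrt_pos.2 hk).ne'
  simp [oscVel, slowAmp, fastAmp]; field_simp; ring

theorem slowAmp_pos {α k p q : ℝ} (hα : 1 < α) (hk : 0 < k) (hp : 0 ≤ p) (hq : 0 < q) :
    0 < slowAmp α k p q := by
  have h1 : 0 < q / √k := div_pos hq (sqrt_pos.2 hk)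
  have h2 := mul_nonpos_of_nonpos_of_nonneg (xi₂_neg hα).le hp
  exact div_pos (by linarith) (sub_pos.2 (xi₂_lt_xi₁ hα))

theorem fastAmp_nonpos {α k p q : ℝ} (hα : 1 < α) (hp : 0 ≤ p) (hq : 0 < q) :
    fastAmp α k p q ≤ 0 := by
  have h1 : 0 ≤ q / √k := by positivity
  have h2 := mul_nonpos_of_nonpos_of_nonneg (xi₁_neg hα).le hp
  exact div_nonpos_of_nonpos_of_nonneg (by linarith) (sub_pos.2 (xi₂_lt_xi₁ hα)).le

/-- Since the two amplitudes add up to p, the position is A(e^{ξ₁t√k} - e^{ξ₂t√k}) + p e^{ξ₂t√k}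
with A > 0: there is no overshoot. -/
theorem oscPos_pos {α k p q t : ℝ} (hα : 1 < α) (hk : 0 < k) (hp : 0 ≤ p) (hq : 0 < q)
    (ht : 0 < t) : 0 < oscPos α k p q t := by
  have hlt : exp (xi₂ α * t * √k) < exp (xi₁ α * t * √k) := by
    have := sqrt_pos.2 hk
    have := xi₂_lt_xi₁ hα
    gcongr
  have hA := slowAmp_pos hα hk hp hq
  have hB := slowAmp_add_fastAmp hα k p q
  have h1 := mul_pos hA (sub_pos.2 hlt)
  have h2 := mul_nonneg hp (exp_pos (xi₂ α * t * √k)).le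
  have : oscPos α k p q t = slowAmp α k p q * (exp (xi₁ α * t * √k) - exp (xi₂ α * t * √k))
      + p * exp (xi₂ α * t * √k) := by
    unfold oscPos; linear_combination (exp (xi₂ α * t * √k)) * hB
  linarith

theorem oscPos_le {α k p q : ℝ} (hα : 1 < α) (hp : 0 ≤ p) (hq : 0 < q) (t : ℝ) :
    oscPos α k p q t ≤ slowAmp α k p q * exp (xi₁ α * t * √k) := by
  have := mul_nonpos_of_nonpos_of_nonneg (fastAmp_nonpos (k := k) hα hp hq)
    (exp_pos (xi₂ α * t * √k)).le
  unfold oscPos; linarith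

/-- The position at time `t` of the motion `u'' = - sideForce φ α k u u'` started at `a` with
velocity `b`. -/
def sidePos (φ α k : ℝ) (a b : Plane) (t : ℝ) : Plane :=
  a + t • b + (oscPos α k (coordY₁ φ a) (coordY₁ φ b) t - coordY₁ φ a - t * coordY₁ φ b)
    • unitVec φ

/-- The velocity at time `t` of the motion `u'' = - sideForce φ α k u u'` started at `a` with
velocity `b`. -/
def sideVel (φ α k : ℝ) (a b : Plane) (t : ℝ) : Plane :=
  b + (oscVel α k (coordY₁ φ a) (coordY₁ φ b) t - coordY₁ φ b) • unitVec φ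

theorem coordY₁_sidePos (φ α k : ℝ) (a b : Plane) (t : ℝ) :
    coordY₁ φ (sidePos φ α k a b t) = oscPos α k (coordY₁ φ a) (coordY₁ φ b) t := by
  simp [sidePos, coordY₁_add, coordY₁_smul]

theorem coordY₂_sidePos (φ α k : ℝ) (a b : Plane) (t : ℝ) :
    coordY₂ φ (sidePos φ α k a b t) = coordY₂ φ a + t * coordY₂ φ b := by
  simp [sidePos, coordY₂_add, coordY₂_smul]

theorem coordY₁_sideVel (φ α k : ℝ) (a b : Plane) (t : ℝ) :
    coordY₁ φ (sideVel φ α k a b t) = oscVel α k (coordY₁ φ a) (coordY₁ φ b) t := by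
  simp [sideVel, coordY₁_add, coordY₁_smul]

theorem coordY₂_sideVel (φ α k : ℝ) (a b : Plane) (t : ℝ) :
    coordY₂ φ (sideVel φ α k a b t) = coordY₂ φ b := by
  simp [sideVel, coordY₂_add, coordY₂_smul]

theorem sidePos_zero {α : ℝ} (hα : 1 < α) (φ k : ℝ) (a b : Plane) :
    sidePos φ α k a b 0 = a := by
  simp [sidePos, hα]

theorem sideVel_zero {α k : ℝ} (hα : 1 < α) (hk : 0 < k) (φ : ℝ) (a b : Plane) :
    sideVel φ α k a b 0 = b := by
  simp [sideVel, hα, hk]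

theorem hasDerivAt_sidePos (φ α k : ℝ) (a b : Plane) (t : ℝ) :
    HasDerivAt (sidePos φ α k a b) (sideVel φ α k a b t) t := by
  have h1 : HasDerivAt (fun t : ℝ => a + t • b) b t := by
    simpa using ((hasDerivAt_id t).smul_const b).const_add a
  have h2 : HasDerivAt (fun t => oscPos α k (coordY₁ φ a) (coordY₁ φ b) t - coordY₁ φ a
      - t * coordY₁ φ b) (oscVel α k (coordY₁ φ a) (coordY₁ φ b) t - coordY₁ φ b) t := by
    exact (((hasDerivAt_oscPos α k (coordY₁ φ a) (coordY₁ φ b) t).sub_const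
      (coordY₁ φ a)).sub ((hasDerivAt_id t).mul_const (coordY₁ φ b))).congr_deriv (by simp)
  exact h1.add (h2.smul_const (unitVec φ))

theorem hasDerivAt_sideVel {α k : ℝ} (hα : 1 < α) (hk : 0 < k) (φ : ℝ) (a b : Plane) (t : ℝ) :
    HasDerivAt (sideVel φ α k a b)
      (-sideForce φ α k (sidePos φ α k a b t) (sideVel φ α k a b t)) t := by
  have h := (((hasDerivAt_oscVel hα hk (coordY₁ φ a) (coordY₁ φ b) t).sub_const
    (coordY₁ φ b)).smul_const (unitVec φ)).const_add b
  refine h.congr_deriv ?_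
  rw [sideForce, coordY₁_sidePos, coordY₁_sideVel, neg_smul]

/-- Phase-space form of the motion along a side, as a continuous linear map. -/
def sideField (φ α k : ℝ) : Plane × Plane →L[ℝ] Plane × Plane :=
  (ContinuousLinearMap.snd ℝ Plane Plane).prod
    (-(((2 * α * √k) • (coordY₁L φ).comp (ContinuousLinearMap.snd ℝ Plane Plane)
      + k • (coordY₁L φ).comp (ContinuousLinearMap.fst ℝ Plane Plane)).smulRight (unitVec φ)))

theorem sideField_apply (φ α k : ℝ) (u v : Plane) :
    sideField φ α k (u, v) = (v, -sideForce φ α k u v) := rfl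

theorem ContinuousOn.sideForce {φ α k : ℝ} {u v : ℝ → Plane} {s : Set ℝ} (hu : ContinuousOn u s)
    (hv : ContinuousOn v s) : ContinuousOn (fun t => sideForce φ α k (u t) (v t)) s := by
  have h1 : ContinuousOn (fun t => coordY₁ φ (u t)) s :=
    (continuous_coordY₁ φ).comp_continuousOn hu
  have h2 : ContinuousOn (fun t => coordY₁ φ (v t)) s :=
    (continuous_coordY₁ φ).comp_continuousOn hv
  unfold _root_.sideForce
  fun_prop

/-! ### Identification of the motion outside of the vertex region -/

/-- `(u, v)` solves the penalized equation of motion on `[0, ∞)`, in integrated form. -/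
structure IsPhaseMotion (θ α k : ℝ) (u v : ℝ → Plane) : Prop where
  continuousOn_vel : ContinuousOn v (Ici 0)
  hasDeriv : ∀ t, 0 ≤ t → HasDerivWithinAt u (v t) (Ici 0) t
  integrable : ∀ s t, 0 ≤ s → s ≤ t →
    IntervalIntegrable (fun r => penaltyForce θ α k (u r) (v r)) volume s t
  vel_eq : ∀ s t, 0 ≤ s → s ≤ t → v t = v s - ∫ r in s..t, penaltyForce θ α k (u r) (v r)

/-- Subtracting the integrated equation at two times lets the motion be restarted at any time, which
suits an argument region by region. -/
theorem IsPenalizedMotion.exists_phase {θ α x₂₀ v₁₀ v₂₀ k : ℝ} {u : ℝ → Plane}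
    (h : IsPenalizedMotion θ α x₂₀ v₁₀ v₂₀ k u) :
    ∃ v, u 0 = !₂[0, x₂₀] ∧ v 0 = !₂[v₁₀, v₂₀] ∧ IsPhaseMotion θ α k u v := by
  obtain ⟨h0, v, hc, hd, hi⟩ := h
  refine ⟨v, h0, by simpa using (hi 0 le_rfl).2, hc, hd, fun s t hs hst => ?_, fun s t hs hst => ?_⟩
  · exact (hi s hs).1.symm.trans (hi t (hs.trans hst)).1
  · rw [(hi s hs).2, (hi t (hs.trans hst)).2,
      ← intervalIntegral.integral_add_adjacent_intervals (hi s hs).1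
        ((hi s hs).1.symm.trans (hi t (hs.trans hst)).1)]
    abel

theorem IsPhaseMotion.continuousOn_pos {θ α k : ℝ} {u v : ℝ → Plane}
    (h : IsPhaseMotion θ α k u v) : ContinuousOn u (Ici 0) :=
  fun t ht => (h.hasDeriv t ht).continuousWithinAt

theorem IsPhaseMotion.hasDeriv_right {θ α k : ℝ} {u v : ℝ → Plane}
    (h : IsPhaseMotion θ α k u v) {t : ℝ} (ht : 0 ≤ t) : HasDerivWithinAt u (v t) (Ici t) t :=
  (h.hasDeriv t ht).mono (Ici_subset_Ici.2 ht)

/-- Uniqueness for the motion along a side. -/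
theorem eqOn_side_of_hasDerivWithinAt {φ α k : ℝ} {u v : ℝ → Plane} (hα : 1 < α) (hk : 0 < k)
    {x y c : ℝ} (hu : ContinuousOn u (Icc x y)) (hv : ContinuousOn v (Icc x y))
    (hu' : ∀ t ∈ Ico x y, HasDerivWithinAt u (v t) (Ici t) t)
    (hv' : ∀ t ∈ Ico x y, HasDerivWithinAt v (-sideForce φ α k (u t) (v t)) (Ici t) t)
    {a b : Plane} (hux : u x = sidePos φ α k a b (x - c))
    (hvx : v x = sideVel φ α k a b (x - c)) :
    ∀ t ∈ Icc x y, u t = sidePos φ α k a b (t - c) ∧ v t = sideVel φ α k a b (t - c) := by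
  have h1 (t : ℝ) := (hasDerivAt_sidePos φ α k a b (t - c)).comp_sub_const t c
  have h2 (t : ℝ) := (hasDerivAt_sideVel hα hk φ a b (t - c)).comp_sub_const t c
  have hf' : ∀ t ∈ Ico x y, HasDerivWithinAt (fun t => (u t, v t))
      (sideField φ α k (u t, v t)) (Ici t) t := fun t ht => by
    rw [sideField_apply]
    exact (hu' t ht).prodMk (hv' t ht)
  have hg (t : ℝ) : HasDerivAt (fun t => (sidePos φ α k a b (t - c), sideVel φ α k a b (t - c)))
      (sideField φ α k (sidePos φ α k a b (t - c), sideVel φ α k a b (t - c))) t := by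
    rw [sideField_apply]
    exact (h1 t).prodMk (h2 t)
  have key : EqOn _ _ (Icc x y) := ODE_solution_unique_of_mem_Icc_right
    (v := fun _ => sideField φ α k)
    (s := fun _ => univ) (K := ‖sideField φ α k‖₊)
    (fun t _ => (sideField φ α k).lipschitz.lipschitzOnWith) (hu.prodMk hv) hf'
    (fun _ _ => mem_univ _) (fun t _ => (hg t).continuousAt.continuousWithinAt)
    (fun t _ => (hg t).hasDerivWithinAt) (fun _ _ => mem_univ _) (by rw [hux, hvx])
  exact fun t ht => Prod.mk.inj (key ht)

/-- As long as the force is that of a side, the motion is the explicit one. -/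
theorem IsPhaseMotion.eqOn_of_forall_mem {θ φ α k : ℝ} {u v : ℝ → Plane} (hα : 1 < α) (hk : 0 < k)
    (h : IsPhaseMotion θ α k u v) {U : Set Plane}
    (hU : ∀ z ∈ U, ∀ w, penaltyForce θ α k z w = sideForce φ α k z w)
    {x y c : ℝ} (hx : 0 ≤ x) (hmem : ∀ t ∈ Ioo x y, u t ∈ U) {a b : Plane}
    (hux : u x = sidePos φ α k a b (x - c)) (hvx : v x = sideVel φ α k a b (x - c)) :
    ∀ t ∈ Icc x y, u t = sidePos φ α k a b (t - c) ∧ v t = sideVel φ α k a b (t - c) := by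
  have hsub : Icc x y ⊆ Ici 0 := fun t ht => hx.trans ht.1
  have hcu := h.continuousOn_pos.mono hsub
  have hcv := h.continuousOn_vel.mono hsub
  have hF : ContinuousOn (fun t => sideForce φ α k (u t) (v t)) (Icc x y) :=
    hcu.sideForce hcv
  have hv : ∀ t ∈ Icc x y, v t = v x - ∫ r in x..t, sideForce φ α k (u r) (v r) := by
    intro t ht
    rw [h.vel_eq x t hx ht.1]
    congr 1
    -- Membership in U is known only in the open interval; the endpoints are a null set.
    rw [intervalIntegral.integral_of_le ht.1, intervalIntegral.integral_of_le ht.1,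
      integral_Ioc_eq_integral_Ioo, integral_Ioc_eq_integral_Ioo]
    exact setIntegral_congr_fun measurableSet_Ioo fun r hr =>
      hU _ (hmem r ⟨hr.1, hr.2.trans_le ht.2⟩) _
  refine eqOn_side_of_hasDerivWithinAt hα hk hcu hcv
    (fun t ht => h.hasDeriv_right (hx.trans ht.1)) (fun t ht => ?_) hux hvx
  have hd : HasDerivWithinAt (fun t => ∫ r in x..t, sideForce φ α k (u r) (v r))
      (sideForce φ α k (u t) (v t)) (Icc x y) t := by
    have : Fact (t ∈ Icc x y) := ⟨Ico_subset_Icc_self ht⟩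
    refine intervalIntegral.integral_hasDerivWithinAt_right
      ((hF.mono ?_).intervalIntegrable) ?_ (hF t this.out)
    · rw [uIcc_of_le ht.1]; exact Icc_subset_Icc_right ht.2.le
    · exact hF.stronglyMeasurableAtFilter_nhdsWithin measurableSet_Icc t
  have h1 : HasDerivWithinAt v (-sideForce φ α k (u t) (v t)) (Icc x y) t :=
    (hd.const_sub (v x)).congr hv (hv t (Ico_subset_Icc_self ht))
  exact h1.mono_of_mem_nhdsWithin
    (mem_of_superset (Icc_mem_nhdsGE ht.2) (Icc_subset_Icc_left ht.1))

/-- If the explicit side motion stays in an open region where the force is that of the side, and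
the motion enters that region immediately, then the motion is the explicit one. -/
theorem IsPhaseMotion.eqOn_sidePos {θ φ α k : ℝ} {u v : ℝ → Plane} (hα : 1 < α) (hk : 0 < k)
    (h : IsPhaseMotion θ α k u v) {U : Set Plane} (hUo : IsOpen U)
    (hU : ∀ z ∈ U, ∀ w, penaltyForce θ α k z w = sideForce φ α k z w)
    {c d : ℝ} (hc : 0 ≤ c) (henter : ∀ᶠ t in 𝓝[>] c, u t ∈ U)
    (hstay : ∀ t ∈ Ioo c d, sidePos φ α k (u c) (v c) (t - c) ∈ U) :
    ∀ t ∈ Icc c d, u t = sidePos φ α k (u c) (v c) (t - c)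
      ∧ v t = sideVel φ α k (u c) (v c) (t - c) := by
  set a := u c
  set b := v c
  have hsub : Icc c d ⊆ Ici 0 := fun t ht => hc.trans ht.1
  have hpos : Continuous fun t => sidePos φ α k a b (t - c) := continuous_iff_continuousAt.2
    fun t => ((hasDerivAt_sidePos φ α k a b (t - c)).comp_sub_const t c).continuousAt
  have hvel : Continuous fun t => sideVel φ α k a b (t - c) := continuous_iff_continuousAt.2
    fun t => ((hasDerivAt_sideVel hα hk φ a b (t - c)).comp_sub_const t c).continuousAt
  -- Continuous induction: the set of agreement is closed in [c, d], contains c, and can be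
  -- prolonged to the right of each of its points before d.
  let S : Set ℝ := {t | u t = sidePos φ α k a b (t - c) ∧ v t = sideVel φ α k a b (t - c)}
  have hclosed : IsClosed (S ∩ Icc c d) := by
    have e : S ∩ Icc c d = Icc c d ∩ (fun t => (u t - sidePos φ α k a b (t - c),
        v t - sideVel φ α k a b (t - c))) ⁻¹' {0} := by
      ext t; simp [S, sub_eq_zero, and_comm]
    rw [e]
    refine ContinuousOn.preimage_isClosed_of_isClosed ?_ isClosed_Icc isClosed_singleton
    exact ((h.continuousOn_pos.mono hsub).sub hpos.continuousOn).prodMk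
      ((h.continuousOn_vel.mono hsub).sub hvel.continuousOn)
  refine hclosed.Icc_subset_of_forall_exists_gt
    ⟨by simp [sidePos_zero hα, a], by simp [sideVel_zero hα hk, b]⟩ ?_
  rintro x ⟨⟨hux, hvx⟩, hcx, hxd⟩ y hxy
  -- At c itself the motion may lie on the boundary of U, so entry is a separate hypothesis; at
  -- later times it follows from openness and agreement with the explicit motion.
  have hev : ∀ᶠ t in 𝓝[>] x, u t ∈ U := by
    rcases hcx.eq_or_lt with rfl | hlt
    · exact henter
    · have hx : u x ∈ U := hux ▸ hstay x ⟨hlt, hxd⟩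
      have : ContinuousWithinAt u (Ioi x) x := (h.continuousOn_pos x (hc.trans hcx)).mono
        fun t ht => (hc.trans hcx).trans (le_of_lt ht)
      exact this.eventually (hUo.mem_nhds hx)
  obtain ⟨z, hz, hzU⟩ := mem_nhdsGT_iff_exists_Ioo_subset.1 hev
  have hm : x < min z y := lt_min hz hxy
  refine ⟨min z y, ?_, hm, min_le_right _ _⟩
  exact h.eqOn_of_forall_mem hα hk hU (hc.trans hcx)
    (fun t ht => hzU ⟨ht.1, ht.2.trans_le (min_le_left _ _)⟩) hux hvx _ ⟨hm.le, le_rfl⟩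

theorem HasDerivWithinAt.eventually_pos {f : ℝ → ℝ} {f' c : ℝ}
    (h : HasDerivWithinAt f f' (Ici c) c) (hf' : 0 < f') (hc : f c = 0) :
    ∀ᶠ t in 𝓝[>] c, 0 < f t := by
  have h1 := (hasDerivWithinAt_iff_tendsto_slope' (by simp)).1 (h.mono Ioi_subset_Ici_self)
  filter_upwards [h1.eventually (lt_mem_nhds hf'), self_mem_nhdsWithin] with t ht htc
  rw [slope_def_field, hc, sub_zero] at ht
  exact (div_pos_iff_of_pos_right (sub_pos.2 htc)).1 ht

theorem isOpen_firstRegion : IsOpen {z : Plane | 0 < coordY₁ 0 z ∧ coordY₂ 0 z < 0} :=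
  (isOpen_lt continuous_const (continuous_coordY₁ 0)).inter
    (isOpen_lt (continuous_coordY₂ 0) continuous_const)

theorem isOpen_interior_region₃ (θ : ℝ) : IsOpen {z : Plane | 0 < coordY₁ θ z ∧ 0 < coordY₂ θ z} :=
  (isOpen_lt continuous_const (continuous_coordY₁ θ)).inter
    (isOpen_lt continuous_const (continuous_coordY₂ θ))

/-- The motion along the first side, up to the corner. -/
theorem IsPhaseMotion.first_side {θ α x₂₀ v₁₀ v₂₀ k : ℝ} {u v : ℝ → Plane} (hθ₀ : 0 ≤ sin θ)
    (hα : 1 < α) (hx : x₂₀ < 0) (hv₁ : 0 < v₁₀) (hv₂ : 0 < v₂₀) (hk : 0 < k)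
    (h : IsPhaseMotion θ α k u v) (hu0 : u 0 = !₂[0, x₂₀]) (hv0 : v 0 = !₂[v₁₀, v₂₀]) :
    ∀ t ∈ Icc 0 (cornerTime x₂₀ v₂₀), u t = sidePos 0 α k !₂[0, x₂₀] !₂[v₁₀, v₂₀] t
      ∧ v t = sideVel 0 α k !₂[0, x₂₀] !₂[v₁₀, v₂₀] t := by
  have key := h.eqOn_sidePos (φ := 0) (c := 0) (d := cornerTime x₂₀ v₂₀) hα hk
    isOpen_firstRegion
    (fun z hz w => penaltyForce_of_first_region hθ₀ (by simpa using hz.1) (by simpa using hz.2.le))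
    le_rfl ?_ ?_
  · simpa [hu0, hv0] using key
  · have h1 : ∀ᶠ t in 𝓝[>] (0 : ℝ), 0 < coordY₁ 0 (u t) :=
      (h.hasDeriv 0 le_rfl).coordY₁.eventually_pos (by simpa [hv0] using hv₁) (by simp [hu0])
    have h2 : ∀ᶠ t in 𝓝[>] (0 : ℝ), coordY₂ 0 (u t) < 0 := by
      have hc : ContinuousWithinAt (fun t => coordY₂ 0 (u t)) (Ioi 0) 0 :=
        ((h.hasDeriv 0 le_rfl).coordY₂.continuousWithinAt).mono Ioi_subset_Ici_self
      exact hc.eventually (gt_mem_nhds (by simpa [hu0] using hx))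
    filter_upwards [h1, h2] with t h1 h2 using ⟨h1, h2⟩
  · intro t ht
    refine ⟨?_, ?_⟩
    · rw [coordY₁_sidePos, hu0, hv0]
      exact oscPos_pos hα hk (by simp) (by simpa using hv₁) (by simpa using ht.1)
    · rw [coordY₂_sidePos, hu0, hv0]
      have := (lt_div_iff₀ hv₂).1 ht.2
      simp; linarith

/-- The motion along the second side, from the time at which it enters the third region. -/
theorem IsPhaseMotion.second_side {θ α k T : ℝ} {u v : ℝ → Plane} (hθ₀ : 0 ≤ sin θ)
    (hα : 1 < α) (hk : 0 < k) (h : IsPhaseMotion θ α k u v) (hT : 0 ≤ T)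
    (h1 : 0 < coordY₁ θ (u T)) (h2 : coordY₂ θ (u T) = 0) (h3 : 0 < coordY₁ θ (v T))
    (h4 : 0 < coordY₂ θ (v T)) :
    ∀ t, T ≤ t → u t = sidePos θ α k (u T) (v T) (t - T) := by
  intro t ht
  refine (h.eqOn_sidePos (φ := θ) (c := T) (d := t) hα hk (isOpen_interior_region₃ θ)
    (fun z hz w => penaltyForce_of_mem_region₃ hθ₀ hz.1 hz.2.le) hT ?_ ?_ t ⟨ht, le_rfl⟩).1
  · have e1 : ∀ᶠ t in 𝓝[>] T, 0 < coordY₁ θ (u t) := by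
      have hc : ContinuousWithinAt (fun t => coordY₁ θ (u t)) (Ioi T) T :=
        ((h.hasDeriv_right hT).coordY₁.continuousWithinAt).mono Ioi_subset_Ici_self
      exact hc.eventually (lt_mem_nhds h1)
    filter_upwards [e1, (h.hasDeriv_right hT).coordY₂.eventually_pos h4 h2] with t h1 h2
      using ⟨h1, h2⟩
  · intro s hs
    have hs' : 0 < s - T := sub_pos.2 hs.1
    refine ⟨?_, ?_⟩
    · rw [coordY₁_sidePos]
      exact oscPos_pos hα hk h1.le h3 hs'
    · rw [coordY₂_sidePos, h2, zero_add]
      exact mul_pos hs' h4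

/-! ### The passage through the vertex region -/

/-- A velocity changes little over a time that is short compared to `1 / √k`. -/
theorem norm_vel_sub_le {α k a b σ : ℝ} {u v : ℝ → Plane} (hα : 0 ≤ α) (hk : 0 ≤ k) (hab : a ≤ b)
    (hv : ContinuousOn v (Icc a b))
    (hu : ∀ t ∈ Icc a b, HasDerivWithinAt u (v t) (Icc a b) t)
    (hF : ∀ M, (∀ s ∈ Icc a b, 2 * α * √k * ‖v s‖ + k * ‖u s‖ ≤ M) →
      ∀ t ∈ Icc a b, ‖v t - v a‖ ≤ M * (t - a))
    (hσ : σ = √k * (b - a)) (hσs : σ * (2 * α + σ) ≤ 1 / 2) :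
    ∀ t ∈ Icc a b, ‖v t - v a‖
      ≤ σ * ((2 * α + σ) * (2 * (‖v a‖ + σ * (√k * ‖u a‖))) + √k * ‖u a‖) := by
  have hab' : 0 ≤ b - a := sub_nonneg.2 hab
  have hs : √k * √k = k := mul_self_sqrt hk
  have hσ0 : 0 ≤ σ := hσ ▸ by positivity
  obtain ⟨s₀, hs₀, hmax⟩ := isCompact_Icc.exists_isMaxOn (nonempty_Icc.2 hab) hv.norm
  set m := ‖v s₀‖ with hm
  have hvm : ∀ t ∈ Icc a b, ‖v t‖ ≤ m := fun t ht => hmax ht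
  have hum : ∀ t ∈ Icc a b, ‖u t‖ ≤ ‖u a‖ + m * (b - a) := by
    intro t ht
    have h1 := norm_image_sub_le_of_norm_deriv_le_segment' hu
      (fun x hx => hvm x (Ico_subset_Icc_self hx)) t ht
    have h2 : ‖u t‖ ≤ ‖u a‖ + ‖u t - u a‖ := norm_le_norm_add_norm_sub' _ _
    have h3 : m * (t - a) ≤ m * (b - a) :=
      mul_le_mul_of_nonneg_left (by linarith [ht.2]) (norm_nonneg _)
    linarith
  have hdiff : ∀ t ∈ Icc a b, ‖v t - v a‖ ≤ σ * ((2 * α + σ) * m + √k * ‖u a‖) := by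
    intro t ht
    have h1 := hF (2 * α * √k * m + k * (‖u a‖ + m * (b - a)))
      (fun s hs => by gcongr; exacts [hvm s hs, hum s hs]) t ht
    refine h1.trans ?_
    calc _ ≤ (2 * α * √k * m + k * (‖u a‖ + m * (b - a))) * (b - a) := by
          gcongr; exact ht.2
      _ = _ := by
          rw [hσ]
          linear_combination (- (b - a) * (‖u a‖ + m * (b - a))) * hs
  -- Bootstrap: at the maximum of the speed, `hdiff` bounds m by ‖v a‖ + m/2 + σ√k‖u a‖, and m/2 is
  -- absorbed.
  have hm2 : m ≤ 2 * (‖v a‖ + σ * (√k * ‖u a‖)) := by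
    have h1 := hdiff s₀ hs₀
    have h2 : m ≤ ‖v a‖ + ‖v s₀ - v a‖ := norm_le_norm_add_norm_sub' _ _
    have h3 : σ * (2 * α + σ) * m ≤ 1 / 2 * m := mul_le_mul_of_nonneg_right hσs (norm_nonneg _)
    nlinarith
  intro t ht
  refine (hdiff t ht).trans ?_
  gcongr

/-- The length of a time interval long enough for crossing the vertex region from `(X, 0)`. -/
def transitTime (θ v₂₀ X : ℝ) : ℝ := 4 * (X * tan θ) / v₂₀

/-- A bound for the deviation of the velocity from `(0, v₂₀)` in the vertex region, where `σ` and
`Q` are the transit time and the initial distance to the vertex multiplied by `√k`, and `D` is the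
normal component of the initial velocity. -/
def cornerErr (α v₂₀ σ Q D : ℝ) : ℝ :=
  σ * ((2 * α + σ) * (2 * (|D| + v₂₀ + σ * Q)) + Q) + |D|

theorem norm_plane_le (x y : ℝ) : ‖(!₂[x, y] : Plane)‖ ≤ |x| + |y| := by
  apply le_of_sq_le_sq _ (by positivity)
  rw [normSq_plane]
  simp only [Matrix.cons_val_zero, Matrix.cons_val_one]
  nlinarith [sq_abs x, sq_abs y, mul_nonneg (abs_nonneg x) (abs_nonneg y)]

/-- What is needed in order to cross the vertex region almost freely. -/
structure CornerSmall (θ α v₂₀ σ Q D : ℝ) : Prop where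
  time_small : σ * (2 * α + σ) ≤ 1 / 2
  le_cos : cornerErr α v₂₀ σ Q D ≤ v₂₀ * cos θ / 2
  le_sin : cornerErr α v₂₀ σ Q D ≤ v₂₀ * sin θ / 2
  le_cot : cornerErr α v₂₀ σ Q D * (4 * tan θ / v₂₀) ≤ 1 / 2

/-- The force enters only through the bound `hF`, so the lemma serves both for arbitrary solutions
and for solutions of the regularized field used for existence. -/
theorem norm_vel_sub_free_le {θ α v₂₀ k a X D : ℝ} {u v : ℝ → Plane} (hα : 0 ≤ α)
    (hk : 0 ≤ k) (hv₂ : 0 < v₂₀) (hX : 0 ≤ X) (htan : 0 ≤ tan θ)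
    (hv : ContinuousOn v (Icc a (a + transitTime θ v₂₀ X)))
    (hu : ∀ t ∈ Icc a (a + transitTime θ v₂₀ X),
      HasDerivWithinAt u (v t) (Icc a (a + transitTime θ v₂₀ X)) t)
    (hF : ∀ M, (∀ s ∈ Icc a (a + transitTime θ v₂₀ X), 2 * α * √k * ‖v s‖ + k * ‖u s‖ ≤ M) →
      ∀ t ∈ Icc a (a + transitTime θ v₂₀ X), ‖v t - v a‖ ≤ M * (t - a))
    (hua : u a = !₂[X, 0]) (hva : v a = !₂[D, v₂₀])
    (hsmall : CornerSmall θ α v₂₀ (√k * transitTime θ v₂₀ X) (√k * X) D) :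
    ∀ t ∈ Icc a (a + transitTime θ v₂₀ X), ‖v t - !₂[0, v₂₀]‖
      ≤ cornerErr α v₂₀ (√k * transitTime θ v₂₀ X) (√k * X) D := by
  intro t ht
  have hh : 0 ≤ transitTime θ v₂₀ X := by unfold transitTime; positivity
  have h1 := norm_vel_sub_le hα hk (by linarith) hv hu hF (σ := √k * transitTime θ v₂₀ X)
    (by ring) hsmall.time_small t ht
  have h2 : ‖u a‖ ≤ X := by simpa [hua, abs_of_nonneg hX] using norm_plane_le X 0
  have h3 : ‖v a‖ ≤ |D| + v₂₀ := by simpa [hva, abs_of_pos hv₂] using norm_plane_le D v₂₀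
  have h4 : ‖v a - !₂[0, v₂₀]‖ ≤ |D| := by
    have : v a - !₂[0, v₂₀] = !₂[D, 0] := by
      rw [hva]; ext i; fin_cases i <;> simp
    rw [this]; simpa using norm_plane_le D 0
  calc ‖v t - !₂[0, v₂₀]‖
      _ ≤ ‖v t - v a‖ + ‖v a - !₂[0, v₂₀]‖ := norm_sub_le_norm_sub_add_norm_sub _ _ _
      _ ≤ _ := by
        unfold cornerErr
        refine add_le_add (h1.trans ?_) h4
        gcongr

theorem IsPhaseMotion.norm_vel_sub_le_mul {θ α k : ℝ} {u v : ℝ → Plane} (hα : 0 ≤ α) (hk : 0 ≤ k)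
    (h : IsPhaseMotion θ α k u v) {a b : ℝ} (ha : 0 ≤ a) (M : ℝ)
    (hM : ∀ s ∈ Icc a b, 2 * α * √k * ‖v s‖ + k * ‖u s‖ ≤ M) :
    ∀ t ∈ Icc a b, ‖v t - v a‖ ≤ M * (t - a) := by
  intro t ht
  rw [h.vel_eq a t ha ht.1, sub_sub_cancel_left, norm_neg]
  have := intervalIntegral.norm_integral_le_of_norm_le_const (a := a) (b := t) (C := M)
    (f := fun r => penaltyForce θ α k (u r) (v r)) fun r hr => by
      rw [uIoc_of_le ht.1] at hr
      exact (norm_penaltyForce_le hα hk _ _).trans (hM r ⟨hr.1.le, hr.2.trans ht.2⟩)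
  rwa [abs_of_nonneg (sub_nonneg.2 ht.1)] at this

/-- A curve whose velocity is almost constant is almost straight. -/
theorem norm_sub_sub_smul_le {a b ρ : ℝ} {u v : ℝ → Plane} {w : Plane}
    (hu : ∀ t ∈ Icc a b, HasDerivWithinAt u (v t) (Icc a b) t)
    (hρ : ∀ t ∈ Icc a b, ‖v t - w‖ ≤ ρ) {s t : ℝ} (hs : a ≤ s) (hst : s ≤ t) (ht : t ≤ b) :
    ‖u t - u s - (t - s) • w‖ ≤ ρ * (t - s) := by
  have hsub : Icc s t ⊆ Icc a b := Icc_subset_Icc hs ht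
  have hd : ∀ r ∈ Icc s t, HasDerivWithinAt (fun r => u r - r • w) (v r - w) (Icc s t) r := by
    intro r hr
    have := ((hasDerivAt_id r).smul_const w).hasDerivWithinAt (s := Icc s t)
    simpa using ((hu r (hsub hr)).mono hsub).fun_sub this
  have := norm_image_sub_le_of_norm_deriv_le_segment' hd
    (fun r hr => hρ r (hsub (Ico_subset_Icc_self hr))) t ⟨hst, le_rfl⟩
  have e : u t - u s - (t - s) • w = u t - t • w - (u s - s • w) := by rw [sub_smul]; abel
  rwa [e]

/-- The properties of the time `T` at which a motion that is in `(X, 0)` at time `a` leaves the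
vertex region. -/
structure IsCrossing (θ v₂₀ ρ a X : ℝ) (u v : ℝ → Plane) (T : ℝ) : Prop where
  lt : a < T
  le : T ≤ a + transitTime θ v₂₀ X
  coordY₂_eq : coordY₂ θ (u T) = 0
  coordY₂_neg : ∀ t ∈ Ico a T, coordY₂ θ (u t) < 0
  snd_pos : ∀ t ∈ Ioc a T, 0 < u t 1
  fst_ge : ∀ t ∈ Icc a T, X / 2 ≤ u t 0
  time : |X * sin θ - (T - a) * (v₂₀ * cos θ)| ≤ ρ * (T - a)
  vel : ‖v T - !₂[0, v₂₀]‖ ≤ ρ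
  pos : ‖u T‖ ≤ X + (ρ + v₂₀) * transitTime θ v₂₀ X

/-- This is purely kinematic: a curve whose velocity is within ρ of (0, v₂₀) is compared with a
vertical line, and the equation of motion plays no role. -/
theorem exists_isCrossing {θ v₂₀ a X ρ : ℝ} {u v : ℝ → Plane} (hsin : 0 < sin θ)
    (hcos : 0 < cos θ) (hv₂ : 0 < v₂₀) (hX : 0 < X) (hρ0 : 0 ≤ ρ)
    (hu : ∀ t ∈ Icc a (a + transitTime θ v₂₀ X),
      HasDerivWithinAt u (v t) (Icc a (a + transitTime θ v₂₀ X)) t)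
    (hρ : ∀ t ∈ Icc a (a + transitTime θ v₂₀ X), ‖v t - !₂[0, v₂₀]‖ ≤ ρ)
    (hua : u a = !₂[X, 0]) (hρc : ρ ≤ v₂₀ * cos θ / 2) (hρt : ρ * (4 * tan θ / v₂₀) ≤ 1 / 2) :
    ∃ T, IsCrossing θ v₂₀ ρ a X u v T := by
  set h := transitTime θ v₂₀ X with hh
  have htan : 0 < tan θ := by rw [tan_eq_sin_div_cos]; positivity
  have hpos : 0 < h := by rw [hh, transitTime]; positivity
  have hvc : 0 < v₂₀ * cos θ := mul_pos hv₂ hcos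
  have hw2 : coordY₂ θ !₂[0, v₂₀] = v₂₀ * cos θ := by simp [coordY₂]
  have hline := @norm_sub_sub_smul_le a (a + h) ρ u v !₂[0, v₂₀] hu hρ
  have hY2 : ∀ s t, a ≤ s → s ≤ t → t ≤ a + h →
      |coordY₂ θ (u t) - coordY₂ θ (u s) - (t - s) * (v₂₀ * cos θ)| ≤ ρ * (t - s) := by
    intro s t h1 h2 h3
    refine le_trans (le_of_eq ?_) ((abs_coordY₂_le θ _).trans (hline h1 h2 h3))
    rw [← hw2]; simp only [coordY₂, PiLp.sub_apply, PiLp.smul_apply, smul_eq_mul]; ring_nf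
  have hYa : coordY₂ θ (u a) = - (X * sin θ) := by rw [hua]; simp [coordY₂]
  have hXs : 0 < X * sin θ := mul_pos hX hsin
  -- The window is four times the free crossing time. As y₂ increases at least at half its free
  -- rate, it gains at least 2X sin θ, more than the required X sin θ.
  have hYb : 0 < coordY₂ θ (u (a + h)) := by
    have h1 := (abs_le.1 (hY2 a (a + h) le_rfl (by linarith) le_rfl)).1
    have h2 : h * (v₂₀ * cos θ) = 4 * (X * sin θ) := by
      rw [hh, transitTime, tan_eq_sin_div_cos]; field_simp
    have h3 : ρ * h ≤ v₂₀ * cos θ / 2 * h := by gcongr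
    rw [hYa, add_sub_cancel_left] at h1
    linarith
  have hcY : ContinuousOn (fun t => coordY₂ θ (u t)) (Icc a (a + h)) :=
    (continuous_coordY₂ θ).comp_continuousOn fun t ht => (hu t ht).continuousWithinAt
  obtain ⟨T, hT, hT0⟩ := intermediate_value_Ioo (by linarith) hcY
    (show (0 : ℝ) ∈ Ioo _ _ from ⟨by rw [hYa]; linarith, hYb⟩)
  simp only at hT0
  have hTle := hT.2.le
  refine ⟨T, hT.1, hTle, hT0, ?_, ?_, ?_, ?_, hρ T (Ioo_subset_Icc_self hT), ?_⟩
  · intro t ht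
    -- Comparing t with T, rather than with a, uses that y₂ is strictly increasing, so that T is the
    -- first zero.
    have h1 := (abs_le.1 (hY2 t T ht.1 ht.2.le hTle)).1
    rw [hT0] at h1
    have h2 := mul_le_mul_of_nonneg_right hρc (sub_pos.2 ht.2).le
    have h3 := mul_pos hvc (sub_pos.2 ht.2)
    linarith
  · intro t ht
    have h1 := (abs_coordY₂_le 0 _).trans (hline le_rfl ht.1.le (ht.2.trans hTle))
    have h2 := (abs_le.1 h1).1
    simp only [coordY₂_zero_angle, PiLp.sub_apply, PiLp.smul_apply, smul_eq_mul, hua,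
      Matrix.cons_val_one] at h2
    have h3 : v₂₀ * cos θ ≤ v₂₀ := mul_le_of_le_one_right hv₂.le (cos_le_one θ)
    have h4 : 0 < t - a := sub_pos.2 ht.1
    have h5 := mul_le_mul_of_nonneg_right (show ρ ≤ v₂₀ / 2 by linarith) h4.le
    have h6 := mul_pos hv₂ h4
    simp at h2
    linarith
  · intro t ht
    have h1 := (abs_coordY₁_le 0 _).trans (hline le_rfl ht.1 (ht.2.trans hTle))
    have h2 := (abs_le.1 h1).1
    simp only [coordY₁_zero_angle, PiLp.sub_apply, PiLp.smul_apply, smul_eq_mul, hua,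
      Matrix.cons_val_zero, mul_zero, sub_zero] at h2
    have h3 : ρ * (t - a) ≤ ρ * h := by gcongr; linarith [ht.2]
    -- The horizontal drift is at most half the initial distance; this keeps the motion away from
    -- the singularity of G at the vertex.
    have h4 : ρ * h ≤ X / 2 := by
      have : ρ * h = ρ * (4 * tan θ / v₂₀) * X := by rw [hh, transitTime]; ring
      rw [this]; nlinarith
    simp at h2
    linarith
  · have h1 := hY2 a T le_rfl hT.1.le hTle
    rw [hT0, hYa] at h1
    simpa using h1
  · have h1 := hline le_rfl hT.1.le hTle
    have h2 : ‖u a‖ ≤ X := by simpa [hua, abs_of_pos hX] using norm_plane_le X 0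
    have h3 : ‖(T - a) • (!₂[0, v₂₀] : Plane)‖ ≤ (T - a) * v₂₀ := by
      rw [norm_smul, norm_of_nonneg (sub_pos.2 hT.1).le]
      have := sub_pos.2 hT.1
      gcongr
      simpa [abs_of_pos hv₂] using norm_plane_le 0 v₂₀
    have h4 : u T = u T - u a - (T - a) • !₂[0, v₂₀] + (u a + (T - a) • !₂[0, v₂₀]) := by abel
    have h5 : ‖u T‖ ≤ ρ * (T - a) + (X + (T - a) * v₂₀) := by
      rw [h4]
      exact (norm_add_le _ _).trans (add_le_add h1 ((norm_add_le _ _).trans (add_le_add h2 h3)))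
    have h6 : (ρ + v₂₀) * (T - a) ≤ (ρ + v₂₀) * h := by gcongr; linarith
    linarith

theorem IsCrossing.mem_region₂ {θ v₂₀ ρ a X T : ℝ} {u v : ℝ → Plane}
    (h : IsCrossing θ v₂₀ ρ a X u v T) (ha : u a 1 = 0) {t : ℝ} (ht : t ∈ Icc a T) :
    u t ∈ region₂ θ := by
  constructor
  · rcases ht.1.eq_or_lt with rfl | h'
    · exact ha.ge
    · exact (h.snd_pos t ⟨h', ht.2⟩).le
  · rcases ht.2.eq_or_lt with rfl | h'
    · exact h.coordY₂_eq.le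
    · exact (h.coordY₂_neg t ⟨ht.1, h'⟩).le

theorem IsCrossing.coordY₁_pos {θ v₂₀ ρ a X T : ℝ} {u v : ℝ → Plane} (hsin : 0 < sin θ)
    (hcos : 0 < cos θ) (hX : 0 < X) (h : IsCrossing θ v₂₀ ρ a X u v T) :
    0 < coordY₁ θ (u T) := by
  have h1 := h.snd_pos T ⟨h.lt, le_rfl⟩
  have h0 := h.fst_ge T ⟨h.lt.le, le_rfl⟩
  have : 0 < u T 0 := by linarith
  unfold coordY₁
  positivity

theorem IsCrossing.abs_coordY₁_vel {θ v₂₀ ρ a X T : ℝ} {u v : ℝ → Plane}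
    (h : IsCrossing θ v₂₀ ρ a X u v T) : |coordY₁ θ (v T) - v₂₀ * sin θ| ≤ ρ := by
  refine le_trans (le_of_eq ?_) ((abs_coordY₁_le θ _).trans h.vel)
  simp [coordY₁]; ring_nf

theorem IsCrossing.abs_coordY₂_vel {θ v₂₀ ρ a X T : ℝ} {u v : ℝ → Plane}
    (h : IsCrossing θ v₂₀ ρ a X u v T) : |coordY₂ θ (v T) - v₂₀ * cos θ| ≤ ρ := by
  refine le_trans (le_of_eq ?_) ((abs_coordY₂_le θ _).trans h.vel)
  simp [coordY₂]; ring_nf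

/-! ### Existence -/

/-- Replaces the first coordinate by its maximum with `δ`. -/
def clipFst (δ : ℝ) (u : Plane) : Plane := !₂[max (u 0) δ, u 1]

theorem clipFst_eq_self {δ : ℝ} {u : Plane} (h : δ ≤ u 0) : clipFst δ u = u := by
  ext i; fin_cases i <;> simp [clipFst, h]

theorem clipFst_ne_zero {δ : ℝ} (hδ : 0 < δ) (u : Plane) : clipFst δ u ≠ 0 := by
  intro h
  have := congrArg (fun x : Plane => x 0) h
  simp only [clipFst, Matrix.cons_val_zero, PiLp.zero_apply] at this
  have h2 := le_max_right (u 0) δ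
  linarith

theorem lipschitzWith_clipFst (δ : ℝ) : LipschitzWith 1 (clipFst δ) := by
  refine LipschitzWith.of_dist_le_mul fun x y => ?_
  rw [NNReal.coe_one, one_mul, dist_eq_norm, dist_eq_norm]
  apply le_of_sq_le_sq _ (norm_nonneg _)
  rw [normSq_plane, normSq_plane]
  simp only [clipFst, PiLp.sub_apply, Matrix.cons_val_zero, Matrix.cons_val_one]
  have := sq_le_sq.2 (abs_max_sub_max_le_abs (x 0) (y 0) δ)
  linarith

/-- The vector field of the motion in the vertex region, with the direction of the damping
modified where the first coordinate is less than `δ`. -/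
def vertexField (α k δ : ℝ) (z : Plane × Plane) : Plane × Plane :=
  (z.2, -((2 * α * √k) • ((inner ℝ z.2 (clipFst δ z.1) / ‖clipFst δ z.1‖ ^ 2) • clipFst δ z.1)
    + k • z.1))

/-- The damping direction at the vertex is smooth away from the vertex. -/
theorem contDiffAt_inner_div_smul {z : Plane × Plane} (hz : z.1 ≠ 0) :
    ContDiffAt ℝ 1 (fun z : Plane × Plane => (inner ℝ z.2 z.1 / ‖z.1‖ ^ 2) • z.1) z := by
  have h1 : ContDiffAt ℝ 1 (fun z : Plane × Plane => ‖z.1‖ ^ 2) z :=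
    (contDiff_fst.norm_sq ℝ).contDiffAt
  have h2 : ContDiffAt ℝ 1 (fun z : Plane × Plane => inner ℝ z.2 z.1) z :=
    contDiffAt_snd.inner ℝ contDiffAt_fst
  exact (h2.div h1 (pow_ne_zero 2 (norm_ne_zero_iff.2 hz))).smul contDiffAt_fst

/-- Clipping is Lipschitz but not differentiable, so the smooth factor is treated on the compact
image, where locally Lipschitz implies Lipschitz. -/
theorem IsCompact.exists_lipschitzOnWith_comp {E F G : Type*} [PseudoMetricSpace E]
    [NormedAddCommGroup F] [NormedSpace ℝ F] [NormedAddCommGroup G] [NormedSpace ℝ G]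
    {s : Set E} (hs : IsCompact s) {p : E → F} {C : NNReal} (hp : LipschitzWith C p) {f : F → G}
    (hf : ∀ z ∈ s, ContDiffAt ℝ 1 f (p z)) : ∃ K, LipschitzOnWith K (f ∘ p) s := by
  have hg : LocallyLipschitzOn (p '' s) f := by
    rintro _ ⟨z, hz, rfl⟩
    obtain ⟨K, t, ht, hK⟩ := (hf z hz).exists_lipschitzOnWith
    exact ⟨K, t, mem_nhdsWithin_of_mem_nhds ht, hK⟩
  obtain ⟨K, hK⟩ := hg.exists_lipschitzOnWith_of_compact (hs.image hp.continuous)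
  exact ⟨_, hK.comp hp.lipschitzOnWith (mapsTo_image _ _)⟩

theorem lipschitzWith_prodMap_clipFst (δ : ℝ) :
    LipschitzWith (max (1 * 1) 1) (fun z : Plane × Plane => (clipFst δ z.1, z.2)) :=
  ((lipschitzWith_clipFst δ).comp LipschitzWith.prod_fst).prodMk LipschitzWith.prod_snd

theorem exists_lipschitzOnWith_clip_damping {δ : ℝ} (hδ : 0 < δ) (c : Plane × Plane) (r : ℝ) :
    ∃ K, LipschitzOnWith K (fun z : Plane × Plane =>
      (inner ℝ z.2 (clipFst δ z.1) / ‖clipFst δ z.1‖ ^ 2) • clipFst δ z.1)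
      (Metric.closedBall c r) :=
  (isCompact_closedBall c r).exists_lipschitzOnWith_comp (lipschitzWith_prodMap_clipFst δ)
    fun z _ => contDiffAt_inner_div_smul (z := (clipFst δ z.1, z.2)) (clipFst_ne_zero hδ z.1)

theorem exists_lipschitzOnWith_vertexField (α k : ℝ) {δ : ℝ} (hδ : 0 < δ) (c : Plane × Plane)
    (r : ℝ) : ∃ K, LipschitzOnWith K (vertexField α k δ) (Metric.closedBall c r) := by
  obtain ⟨K, hK⟩ := exists_lipschitzOnWith_clip_damping hδ c r
  have h1 := (lipschitzWith_smul (β := Plane) (2 * α * √k)).comp_lipschitzOnWith hK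
  have h2 := ((lipschitzWith_smul (β := Plane) k).comp
    (LipschitzWith.prod_fst (α := Plane) (β := Plane))).lipschitzOnWith (s := Metric.closedBall c r)
  exact ⟨_, (LipschitzWith.prod_snd.lipschitzOnWith).prodMk (h1.add h2).neg⟩

/-- Clipping changes only the direction onto which the velocity is projected, so the bound for the
true force survives. -/
theorem norm_vertexField_snd_le {α k : ℝ} (hα : 0 ≤ α) (hk : 0 ≤ k) (δ : ℝ)
    (z : Plane × Plane) : ‖(vertexField α k δ z).2‖ ≤ 2 * α * √k * ‖z.2‖ + k * ‖z.1‖ := by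
  simp only [vertexField]
  rw [norm_neg]
  refine (norm_add_le _ _).trans ?_
  rw [norm_smul, norm_smul _ z.1, norm_of_nonneg hk, norm_of_nonneg (by positivity)]
  gcongr
  exact norm_inner_div_smul_le _ _

/-- Existence of a motion near the vertex, over a short time. -/
theorem exists_vertex_motion {α k a h δ V X : ℝ} (hα : 0 ≤ α) (hk : 0 ≤ k) (hδ : 0 < δ)
    (hh : 0 ≤ h) {p q : Plane} (hp : ‖p‖ ≤ X) (hq : ‖q‖ ≤ V)
    (hL : ((V + 1) + (2 * α * √k * (V + 1) + k * (X + 1))) * h ≤ 1) :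
    ∃ u v : ℝ → Plane, u a = p ∧ v a = q ∧
      (∀ t ∈ Icc a (a + h), HasDerivWithinAt u (v t) (Icc a (a + h)) t) ∧
      (∀ t ∈ Icc a (a + h),
        HasDerivWithinAt v (vertexField α k δ (u t, v t)).2 (Icc a (a + h)) t) := by
  obtain ⟨K, hK⟩ := exists_lipschitzOnWith_vertexField α k hδ (p, q) 1
  have hX : 0 ≤ X := (norm_nonneg _).trans hp
  have hV : 0 ≤ V := (norm_nonneg _).trans hq
  set L : ℝ := (V + 1) + (2 * α * √k * (V + 1) + k * (X + 1)) with hLdef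
  have hL0 : 0 ≤ L := by positivity
  -- The field is bounded by L on the unit ball around the initial state, and L h ≤ 1 keeps the
  -- solution in this ball.
  have hPL : IsPicardLindelof (fun _ => vertexField α k δ) (tmin := a) (tmax := a + h)
      ⟨a, le_rfl, by linarith⟩ (p, q) 1 0 ⟨L, hL0⟩ K := by
    refine IsPicardLindelof.of_time_independent ?_ (by simpa using hK) ?_
    · intro z hz
      rw [NNReal.coe_one, mem_closedBall_iff_norm] at hz
      have h1 : ‖z.1‖ ≤ X + 1 := by
        have e : ‖z.1 - p‖ ≤ 1 := (norm_fst_le (z - (p, q))).trans hz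
        have := norm_le_norm_add_norm_sub' z.1 p
        linarith
      have h2 : ‖z.2‖ ≤ V + 1 := by
        have e : ‖z.2 - q‖ ≤ 1 := (norm_snd_le (z - (p, q))).trans hz
        have := norm_le_norm_add_norm_sub' z.2 q
        linarith
      have h3 := norm_vertexField_snd_le hα hk δ z
      have h4 : 2 * α * √k * ‖z.2‖ + k * ‖z.1‖ ≤ 2 * α * √k * (V + 1) + k * (X + 1) := by gcongr
      refine norm_prod_le_iff.2 ⟨?_, ?_⟩
      · change ‖z.2‖ ≤ L
        have : 0 ≤ 2 * α * √k * (V + 1) + k * (X + 1) := by positivity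
        linarith
      · change _ ≤ L
        linarith
    · have e : max (a + h - a) (a - a) = h := by simp [hh]
      change L * max (a + h - a) (a - a) ≤ 1 - 0
      rw [e, sub_zero]
      exact hL
  obtain ⟨w, hw0, hw⟩ := hPL.exists_eq_forall_mem_Icc_hasDerivWithinAt₀
  have hw0' : w a = (p, q) := hw0
  refine ⟨fun t => (w t).1, fun t => (w t).2, by simp [hw0'], by simp [hw0'], fun t ht => ?_,
    fun t ht => ?_⟩
  · exact (ContinuousLinearMap.fst ℝ Plane Plane).hasFDerivAt.comp_hasDerivWithinAt t (hw t ht)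
  · exact (ContinuousLinearMap.snd ℝ Plane Plane).hasFDerivAt.comp_hasDerivWithinAt t (hw t ht)

/-! ### Gluing of motions -/

/-- The function that is `f` up to `c` and `g` afterwards. -/
def glueAt {E : Type*} (c : ℝ) (f g : ℝ → E) (t : ℝ) : E := if t ≤ c then f t else g t

theorem glueAt_eqOn_Iic {E : Type*} (c : ℝ) (f g : ℝ → E) : EqOn (glueAt c f g) f (Iic c) :=
  fun _ ht => if_pos ht

theorem glueAt_eqOn_Ici {E : Type*} {c : ℝ} {f g : ℝ → E} (h : f c = g c) :
    EqOn (glueAt c f g) g (Ici c) := fun t ht => by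
  rcases (mem_Ici.1 ht).eq_or_lt with rfl | h'
  · simp [glueAt, h]
  · simp [glueAt, not_le.2 h']

theorem hasDerivWithinAt_glueAt {a c : ℝ} {f f' g g' : ℝ → Plane} (hac : a ≤ c)
    (hf : ∀ t ∈ Icc a c, HasDerivWithinAt f (f' t) (Icc a c) t)
    (hg : ∀ t ∈ Ici c, HasDerivWithinAt g (g' t) (Ici c) t) (h : f c = g c) (h' : f' c = g' c) :
    ∀ t ∈ Ici a, HasDerivWithinAt (glueAt c f g) (glueAt c f' g' t) (Ici a) t := by
  intro t ht
  have hL : ∀ s ∈ Icc a c, HasDerivWithinAt (glueAt c f g) (glueAt c f' g' s) (Icc a c) s :=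
    fun s hs => by
      rw [glueAt_eqOn_Iic c f' g' hs.2]
      exact (hf s hs).congr (fun r hr => glueAt_eqOn_Iic c f g hr.2) (glueAt_eqOn_Iic c f g hs.2)
  have hR : ∀ s ∈ Ici c, HasDerivWithinAt (glueAt c f g) (glueAt c f' g' s) (Ici c) s :=
    fun s hs => by
      rw [glueAt_eqOn_Ici h' hs]
      exact (hg s hs).congr (glueAt_eqOn_Ici h) (glueAt_eqOn_Ici h hs)
  rcases lt_trichotomy t c with hlt | rfl | hgt
  · refine (hL t ⟨ht, hlt.le⟩).mono_of_mem_nhdsWithin ?_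
    exact inter_mem self_mem_nhdsWithin (mem_nhdsWithin_of_mem_nhds (Iic_mem_nhds hlt))
  · rw [← Icc_union_Ici_eq_Ici hac]
    exact (hL t ⟨ht, le_rfl⟩).union (hR t self_mem_Ici)
  · exact (hR t hgt.le).mono_of_mem_nhdsWithin (mem_nhdsWithin_of_mem_nhds (Ici_mem_nhds hgt))

theorem continuousOn_glueAt {a c : ℝ} {f g : ℝ → Plane} (hac : a ≤ c)
    (hf : ContinuousOn f (Icc a c)) (hg : ContinuousOn g (Ici c)) (h : f c = g c) :
    ContinuousOn (glueAt c f g) (Ici a) := by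
  rw [← Icc_union_Ici_eq_Ici hac]
  exact (hf.congr fun r hr => glueAt_eqOn_Iic c f g hr.2).union_of_isClosed
    (hg.congr (glueAt_eqOn_Ici h)) isClosed_Icc isClosed_Ici

/-- `(u, v)` solves the penalized equation on `[a, ∞)`, up to countably many times. -/
def IsMotionFrom (θ α k a : ℝ) (u v : ℝ → Plane) : Prop :=
  ContinuousOn v (Ici a) ∧ (∀ t ∈ Ici a, HasDerivWithinAt u (v t) (Ici a) t) ∧
    ∃ s : Set ℝ, s.Countable ∧ ∀ t ∈ Ioi a, t ∉ s →
      HasDerivAt v (-penaltyForce θ α k (u t) (v t)) t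

/-- The force may jump at c, so no derivative of the velocity is claimed there: c joins the
countable exceptional set. -/
theorem IsMotionFrom.glueAt {θ α k a c : ℝ} {u v f f' : ℝ → Plane} (h : IsMotionFrom θ α k c u v)
    (hac : a ≤ c) (hf : ∀ t ∈ Icc a c, HasDerivWithinAt f (f' t) (Icc a c) t)
    (hfc : ContinuousOn f' (Icc a c))
    (hf' : ∀ t ∈ Ioo a c, HasDerivAt f' (-penaltyForce θ α k (f t) (f' t)) t)
    (hu : f c = u c) (hv : f' c = v c) :
    IsMotionFrom θ α k a (glueAt c f u) (glueAt c f' v) := by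
  obtain ⟨h1, h2, s, hs, h3⟩ := h
  refine ⟨continuousOn_glueAt hac hfc h1 hv, hasDerivWithinAt_glueAt hac hf h2 hu hv,
    insert c s, hs.insert c, fun t ht hts => ?_⟩
  rw [mem_insert_iff, not_or] at hts
  rcases lt_or_gt_of_ne hts.1 with hlt | hgt
  · have e := glueAt_eqOn_Iic c f' v
    rw [glueAt_eqOn_Iic c f u hlt.le, e hlt.le]
    exact (hf' t ⟨ht, hlt⟩).congr_of_eventuallyEq (e.eventuallyEq_of_mem (Iic_mem_nhds hlt))
  · have e := glueAt_eqOn_Ici (f := f') (g := v) hv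
    rw [glueAt_eqOn_Ici hu (le_of_lt hgt), e (le_of_lt hgt)]
    exact (h3 t hgt hts.2).congr_of_eventuallyEq (e.eventuallyEq_of_mem (Ici_mem_nhds hgt))

theorem IsMotionFrom.isPenalizedMotion {θ α x₂₀ v₁₀ v₂₀ k : ℝ} {u v : ℝ → Plane} (hα : 0 ≤ α)
    (hk : 0 ≤ k) (h : IsMotionFrom θ α k 0 u v) (hu : u 0 = !₂[0, x₂₀])
    (hv : v 0 = !₂[v₁₀, v₂₀]) : IsPenalizedMotion θ α x₂₀ v₁₀ v₂₀ k u := by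
  obtain ⟨h1, h2, s, hs, h3⟩ := h
  refine ⟨hu, v, h1, fun t ht => h2 t ht, fun t ht => ?_⟩
  have hsub : Icc 0 t ⊆ Ici 0 := fun r hr => hr.1
  have hcu : ContinuousOn u (Ici 0) := fun r hr => (h2 r hr).continuousWithinAt
  have hbound : ContinuousOn (fun r => 2 * α * √k * ‖v r‖ + k * ‖u r‖) (Icc 0 t) :=
    (continuousOn_const.mul (h1.mono hsub).norm).add (continuousOn_const.mul (hcu.mono hsub).norm)
  have hint : IntervalIntegrable (fun r => penaltyForce θ α k (u r) (v r)) volume 0 t := by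
    rw [intervalIntegrable_iff_integrableOn_Ioc_of_le ht]
    have hb := (intervalIntegrable_iff_integrableOn_Ioc_of_le ht).1
      (ContinuousOn.intervalIntegrable (μ := volume) (by rwa [uIcc_of_le ht]))
    refine hb.mono' ?_ (Eventually.of_forall fun r => norm_penaltyForce_le hα hk _ _)
    -- Measurability of the force along the motion comes from the equation: almost everywhere it is
    -- -v', and a derivative is measurable. Nothing about the regularity of `projK` is needed.
    have hm : AEStronglyMeasurable (fun r => -deriv v r) (volume.restrict (Ioc 0 t)) :=
      (stronglyMeasurable_deriv v).neg.aestronglyMeasurable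
    refine hm.congr ?_
    have hae : ∀ᵐ r ∂volume.restrict (Ioc 0 t), r ∉ s :=
      ae_restrict_of_ae (hs.ae_notMem volume)
    filter_upwards [hae, ae_restrict_mem measurableSet_Ioc] with r hr hr'
    rw [(h3 r hr'.1 hr).deriv, neg_neg]
  refine ⟨hint, ?_⟩
  have := integral_eq_of_hasDerivAt_off_countable_of_le v
    (fun r => -penaltyForce θ α k (u r) (v r)) ht hs (h1.mono hsub)
    (fun r hr => h3 r hr.1.1 hr.2) hint.neg
  rw [intervalIntegral.integral_neg, hv] at this
  rw [sub_eq_add_neg, this]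
  abel

/-! ### State at the corner and construction of a solution -/

/-- The distance to the vertex of the motion along the first side, at the corner time. -/
def cornerPos (α x₂₀ v₁₀ v₂₀ k : ℝ) : ℝ := oscPos α k 0 v₁₀ (cornerTime x₂₀ v₂₀)

/-- The normal velocity of the motion along the first side, at the corner time. -/
def cornerVel (α x₂₀ v₁₀ v₂₀ k : ℝ) : ℝ := oscVel α k 0 v₁₀ (cornerTime x₂₀ v₂₀)

theorem cornerTime_pos {x₂₀ v₂₀ : ℝ} (hx : x₂₀ < 0) (hv₂ : 0 < v₂₀) : 0 < cornerTime x₂₀ v₂₀ :=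
  div_pos (neg_pos.2 hx) hv₂

theorem cornerPos_pos {α x₂₀ v₁₀ v₂₀ k : ℝ} (hα : 1 < α) (hx : x₂₀ < 0) (hv₁ : 0 < v₁₀)
    (hv₂ : 0 < v₂₀) (hk : 0 < k) : 0 < cornerPos α x₂₀ v₁₀ v₂₀ k :=
  oscPos_pos hα hk le_rfl hv₁ (cornerTime_pos hx hv₂)

theorem sidePos_cornerTime {v₂₀ : ℝ} (hv₂ : 0 < v₂₀) (α x₂₀ v₁₀ k : ℝ) :
    sidePos 0 α k !₂[0, x₂₀] !₂[v₁₀, v₂₀] (cornerTime x₂₀ v₂₀)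
      = !₂[cornerPos α x₂₀ v₁₀ v₂₀ k, 0] := by
  ext i; fin_cases i
  · simpa [cornerPos] using coordY₁_sidePos 0 α k !₂[0, x₂₀] !₂[v₁₀, v₂₀] (cornerTime x₂₀ v₂₀)
  · have := coordY₂_sidePos 0 α k !₂[0, x₂₀] !₂[v₁₀, v₂₀] (cornerTime x₂₀ v₂₀)
    simp only [coordY₂_zero_angle, Matrix.cons_val_one, cornerTime] at this
    simp only [cornerTime, Fin.mk_one, Matrix.cons_val_one]
    rw [this]; simp; field_simp; ring

theorem sideVel_cornerTime (α x₂₀ v₁₀ v₂₀ k : ℝ) :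
    sideVel 0 α k !₂[0, x₂₀] !₂[v₁₀, v₂₀] (cornerTime x₂₀ v₂₀)
      = !₂[cornerVel α x₂₀ v₁₀ v₂₀ k, v₂₀] := by
  ext i; fin_cases i
  · simpa [cornerVel] using coordY₁_sideVel 0 α k !₂[0, x₂₀] !₂[v₁₀, v₂₀] (cornerTime x₂₀ v₂₀)
  · simpa using coordY₂_sideVel 0 α k !₂[0, x₂₀] !₂[v₁₀, v₂₀] (cornerTime x₂₀ v₂₀)

/-- The deviation of the velocity in the vertex region, for the motion under consideration. -/
def velErr (θ α x₂₀ v₁₀ v₂₀ k : ℝ) : ℝ :=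
  cornerErr α v₂₀ (√k * transitTime θ v₂₀ (cornerPos α x₂₀ v₁₀ v₂₀ k))
    (√k * cornerPos α x₂₀ v₁₀ v₂₀ k) (cornerVel α x₂₀ v₁₀ v₂₀ k)

/-- The parameter `k` is so large that the vertex region is crossed almost freely. -/
structure IsStiff (θ α x₂₀ v₁₀ v₂₀ k : ℝ) : Prop where
  pos : 0 < k
  corner : CornerSmall θ α v₂₀ (√k * transitTime θ v₂₀ (cornerPos α x₂₀ v₁₀ v₂₀ k))
    (√k * cornerPos α x₂₀ v₁₀ v₂₀ k) (cornerVel α x₂₀ v₁₀ v₂₀ k)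
  pos_le : √k * cornerPos α x₂₀ v₁₀ v₂₀ k ≤ 1
  picard : ((|cornerVel α x₂₀ v₁₀ v₂₀ k| + v₂₀ + 1) + (2 * α * √k *
    (|cornerVel α x₂₀ v₁₀ v₂₀ k| + v₂₀ + 1) + k * (cornerPos α x₂₀ v₁₀ v₂₀ k + 1)))
    * transitTime θ v₂₀ (cornerPos α x₂₀ v₁₀ v₂₀ k) ≤ 1

theorem isMotionFrom_second_side {θ α k T : ℝ} {a b : Plane} (hsin : 0 ≤ sin θ) (hα : 1 < α)
    (hk : 0 < k) (h1 : 0 < coordY₁ θ a) (h2 : coordY₂ θ a = 0) (h3 : 0 < coordY₁ θ b)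
    (h4 : 0 < coordY₂ θ b) :
    IsMotionFrom θ α k T (fun t => sidePos θ α k a b (t - T))
      (fun t => sideVel θ α k a b (t - T)) := by
  have hd1 (t : ℝ) := (hasDerivAt_sidePos θ α k a b (t - T)).comp_sub_const t T
  have hd2 (t : ℝ) := (hasDerivAt_sideVel hα hk θ a b (t - T)).comp_sub_const t T
  refine ⟨fun t _ => (hd2 t).continuousAt.continuousWithinAt,
    fun t _ => (hd1 t).hasDerivWithinAt, ∅, countable_empty, fun t ht _ => ?_⟩
  have ht' : 0 < t - T := sub_pos.2 ht
  rw [penaltyForce_of_mem_region₃ hsin]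
  · exact hd2 t
  · rw [coordY₁_sidePos]; exact oscPos_pos hα hk h1.le h3 ht'
  · rw [coordY₂_sidePos, h2, zero_add]; exact (mul_pos ht' h4).le

theorem IsStiff.velErr_nonneg {θ α x₂₀ v₁₀ v₂₀ k : ℝ} (hsin : 0 < sin θ) (hcos : 0 < cos θ)
    (hα : 1 < α) (hx : x₂₀ < 0) (hv₁ : 0 < v₁₀) (hv₂ : 0 < v₂₀)
    (hk : IsStiff θ α x₂₀ v₁₀ v₂₀ k) : 0 ≤ velErr θ α x₂₀ v₁₀ v₂₀ k := by
  have hX := cornerPos_pos hα hx hv₁ hv₂ hk.pos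
  have htan : 0 < tan θ := by rw [tan_eq_sin_div_cos]; positivity
  unfold velErr cornerErr transitTime
  positivity

theorem IsStiff.exists_isPenalizedMotion {θ α x₂₀ v₁₀ v₂₀ k : ℝ} (hsin : 0 < sin θ)
    (hcos : 0 < cos θ) (hα : 1 < α) (hx : x₂₀ < 0) (hv₁ : 0 < v₁₀) (hv₂ : 0 < v₂₀)
    (hk : IsStiff θ α x₂₀ v₁₀ v₂₀ k) : ∃ u, IsPenalizedMotion θ α x₂₀ v₁₀ v₂₀ k u := by
  have hk0 := hk.pos
  have hα0 : 0 ≤ α := by linarith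
  have htan : 0 < tan θ := by rw [tan_eq_sin_div_cos]; positivity
  have ht₀ := cornerTime_pos hx hv₂
  have hρ0 := hk.velErr_nonneg hsin hcos hα hx hv₁ hv₂
  have hX := cornerPos_pos hα hx hv₁ hv₂ hk0
  set X := cornerPos α x₂₀ v₁₀ v₂₀ k with hXdef
  set D := cornerVel α x₂₀ v₁₀ v₂₀ k with hDdef
  set t₀ := cornerTime x₂₀ v₂₀ with ht₀def
  have hh : 0 < transitTime θ v₂₀ X := by unfold transitTime; positivity
  -- The clipping level X/2 is the lower bound for x₁ in `IsCrossing`, so up to T the solution of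
  -- the regularized equation solves the true one.
  obtain ⟨u, v, hu0, hv0, hu, hv⟩ := exists_vertex_motion (a := t₀) (δ := X / 2) hα0 hk0.le
    (half_pos hX) hh.le (p := !₂[X, 0]) (q := !₂[D, v₂₀]) (X := X) (V := |D| + v₂₀)
    (by simpa [abs_of_pos hX] using norm_plane_le X 0)
    (by simpa [abs_of_pos hv₂] using norm_plane_le D v₂₀) hk.picard
  set b := t₀ + transitTime θ v₂₀ X with hb
  have hvc : ContinuousOn v (Icc t₀ b) := fun t ht => (hv t ht).continuousWithinAt
  have hfree := norm_vel_sub_free_le hα0 hk0.le hv₂ hX.le htan.le hvc hu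
    (fun M hM t ht => norm_image_sub_le_of_norm_deriv_le_segment' hv
      (fun s hs => (norm_vertexField_snd_le hα0 hk0.le _ _).trans (hM s (Ico_subset_Icc_self hs)))
      t ht) hu0 hv0 hk.corner
  obtain ⟨T, hT⟩ := exists_isCrossing hsin hcos hv₂ hX hρ0 hu hfree hu0 hk.corner.le_cos
    hk.corner.le_cot
  have hsub : Icc t₀ T ⊆ Icc t₀ b := Icc_subset_Icc_right hT.le
  have hvel1 : 0 < coordY₁ θ (v T) := by
    have h1 := (abs_le.1 hT.abs_coordY₁_vel).1
    have h2 : velErr θ α x₂₀ v₁₀ v₂₀ k ≤ _ := hk.corner.le_sin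
    have h3 := mul_pos hv₂ hsin
    linarith
  have hvel2 : 0 < coordY₂ θ (v T) := by
    have h1 := (abs_le.1 hT.abs_coordY₂_vel).1
    have h2 : velErr θ α x₂₀ v₁₀ v₂₀ k ≤ _ := hk.corner.le_cos
    have h3 := mul_pos hv₂ hcos
    linarith
  have m3 := isMotionFrom_second_side (T := T) hsin.le hα hk0 (hT.coordY₁_pos hsin hcos hX)
    hT.coordY₂_eq hvel1 hvel2
  have m2 := m3.glueAt hT.lt.le (fun t ht => (hu t (hsub ht)).mono hsub) (hvc.mono hsub)
    (fun t ht => by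
      have htI := Ioo_subset_Icc_self ht
      have hfst := hT.fst_ge t htI
      have h0 : 0 < u t 0 := by linarith
      rw [penaltyForce_of_mem_region₂ hsin h0 (hT.mem_region₂ (by simp [hu0]) htI)]
      have h1 := (hv t (hsub htI)).hasDerivAt (Icc_mem_nhds ht.1 (ht.2.trans_le hT.le))
      refine h1.congr_deriv ?_
      simp only [vertexField, clipFst_eq_self hfst, vertexForce])
    (by simp [sidePos_zero hα]) (by simp [sideVel_zero hα hk0])
  have m1 := m2.glueAt ht₀.le
    (fun t _ => (hasDerivAt_sidePos 0 α k !₂[0, x₂₀] !₂[v₁₀, v₂₀] t).hasDerivWithinAt)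
    (fun t _ => (hasDerivAt_sideVel hα hk0 0 !₂[0, x₂₀] !₂[v₁₀, v₂₀]
      t).continuousAt.continuousWithinAt)
    (fun t ht => by
      rw [penaltyForce_of_first_region hsin.le]
      · exact hasDerivAt_sideVel hα hk0 0 _ _ t
      · rw [← coordY₁_zero_angle, coordY₁_sidePos]
        exact oscPos_pos hα hk0 (by simp) (by simpa using hv₁) ht.1
      · rw [← coordY₂_zero_angle, coordY₂_sidePos]
        have := (lt_div_iff₀ hv₂).1 ht.2
        simp; linarith)
    (by rw [glueAt_eqOn_Iic _ _ _ (mem_Iic.2 hT.lt.le), hu0, sidePos_cornerTime hv₂])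
    (by rw [glueAt_eqOn_Iic _ _ _ (mem_Iic.2 hT.lt.le), hv0, sideVel_cornerTime])
  refine ⟨_, m1.isPenalizedMotion hα0 hk0.le ?_ ?_⟩
  · rw [glueAt_eqOn_Iic _ _ _ (mem_Iic.2 ht₀.le), sidePos_zero hα]
  · rw [glueAt_eqOn_Iic _ _ _ (mem_Iic.2 ht₀.le), sideVel_zero hα hk0]

/-! ### The shape of every motion -/

/-- A constant for the decay of the normal coordinate along the second side. -/
def decayConst (α v₂₀ : ℝ) : ℝ := (2 * v₂₀ - xi₂ α * (1 + v₂₀)) / (xi₁ α - xi₂ α)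

/-- At the corner time the position is on the first axis, so the radial velocity is the first
component D; the rescaling of time cancels the factor √k. -/
theorem IsPhaseMotion.energyW_eq {θ α x₂₀ v₁₀ v₂₀ k X D : ℝ} {u v : ℝ → Plane} (hx : x₂₀ < 0)
    (hv₂ : 0 < v₂₀) (hk : 0 < k) (h : IsPhaseMotion θ α k u v) (hX : 0 < X)
    (hu : u (cornerTime x₂₀ v₂₀) = !₂[X, 0]) (hv : v (cornerTime x₂₀ v₂₀) = !₂[D, v₂₀]) :
    energyW α x₂₀ v₁₀ v₂₀ k u = (D / etaScale α x₂₀ v₂₀ k) ^ 2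
      + constE α v₁₀ v₂₀ / (√k * X / etaScale α x₂₀ v₂₀ k) ^ 2 := by
  have ht₀ := cornerTime_pos hx hv₂
  set t₀ := cornerTime x₂₀ v₂₀
  have hn : ‖u t₀‖ = X := by
    have : ‖u t₀‖ ^ 2 = X ^ 2 := by rw [hu, normSq_plane]; simp
    exact (pow_left_inj₀ (norm_nonneg _) hX.le two_ne_zero).1 this
  have hd : HasDerivAt u (v t₀) t₀ := (h.hasDeriv t₀ ht₀.le).hasDerivAt (Ici_mem_nhds ht₀)
  have hnorm : HasDerivAt (fun t => ‖u t‖) D t₀ := by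
    have h1 := hd.norm_sq.sqrt (by rw [hn]; positivity)
    have e : (fun t => √(‖u t‖ ^ 2)) = fun t => ‖u t‖ := by
      ext t; exact sqrt_sq (norm_nonneg _)
    have e2 : inner ℝ (u t₀) (v t₀) = X * D := by rw [hu, hv, inner_plane]; simp
    rw [e] at h1
    refine h1.congr_deriv ?_
    rw [e2, sqrt_sq (norm_nonneg _), hn]; field_simp
  have hs : 0 < √k := sqrt_pos.2 hk
  have hR : HasDerivAt (scaledRadius α x₂₀ v₂₀ k u) (D / etaScale α x₂₀ v₂₀ k) 0 := by
    have h1 : HasDerivAt (fun τ : ℝ => t₀ + τ / √k) (1 / √k) 0 :=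
      ((hasDerivAt_id (0 : ℝ)).div_const √k).const_add t₀
    have h2 : HasDerivAt (fun τ : ℝ => ‖u (t₀ + τ / √k)‖) (D * (1 / √k)) 0 :=
      HasDerivAt.comp (h₂ := fun t => ‖u t‖) (0 : ℝ) (by simpa using hnorm) h1
    refine ((h2.const_mul √k).div_const (etaScale α x₂₀ v₂₀ k)).congr_deriv ?_
    field_simp
  rw [energyW, hR.deriv, scaledRadius, zero_div, add_zero, hn]

/-- All conclusions for one stiff k, for an arbitrary solution. The limits later use only the
estimates on T and y₂, both relative to the error `velErr`. -/
theorem IsStiff.passage {θ α x₂₀ v₁₀ v₂₀ k : ℝ} (hsin : 0 < sin θ)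
    (hcos : 0 < cos θ) (hα : 1 < α) (hx : x₂₀ < 0) (hv₁ : 0 < v₁₀) (hv₂ : 0 < v₂₀)
    (hk : IsStiff θ α x₂₀ v₁₀ v₂₀ k) {u : ℝ → Plane}
    (hmot : IsPenalizedMotion θ α x₂₀ v₁₀ v₂₀ k u) :
    energyW α x₂₀ v₁₀ v₂₀ k u = (cornerVel α x₂₀ v₁₀ v₂₀ k / etaScale α x₂₀ v₂₀ k) ^ 2
      + constE α v₁₀ v₂₀ / (√k * cornerPos α x₂₀ v₁₀ v₂₀ k / etaScale α x₂₀ v₂₀ k) ^ 2 ∧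
    ∃ T, cornerTime x₂₀ v₂₀ < T ∧
      |cornerPos α x₂₀ v₁₀ v₂₀ k * sin θ - (T - cornerTime x₂₀ v₂₀) * (v₂₀ * cos θ)|
        ≤ velErr θ α x₂₀ v₁₀ v₂₀ k * (T - cornerTime x₂₀ v₂₀) ∧
      (∀ t, 0 ≤ t → (u t ∈ region₂ θ ↔ cornerTime x₂₀ v₂₀ ≤ t ∧ t ≤ T) ∧
        (u t ∈ region₃ θ ↔ T ≤ t)) ∧
      (∀ t, T ≤ t → 0 ≤ coordY₁ θ (u t) ∧
        coordY₁ θ (u t) ≤ decayConst α v₂₀ * exp (xi₁ α * (t - T) * √k) / √k) ∧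
      (∀ t, T ≤ t → |coordY₂ θ (u t) - (t - T) * (v₂₀ * cos θ)|
        ≤ velErr θ α x₂₀ v₁₀ v₂₀ k * (t - T)) := by
  have hk0 := hk.pos
  have hα0 : 0 ≤ α := by linarith
  have htan : 0 < tan θ := by rw [tan_eq_sin_div_cos]; positivity
  have ht₀ := cornerTime_pos hx hv₂
  have hρ0 := hk.velErr_nonneg hsin hcos hα hx hv₁ hv₂
  have hX := cornerPos_pos hα hx hv₁ hv₂ hk0
  obtain ⟨v, hu0, hv0, h⟩ := hmot.exists_phase
  have hfirst := h.first_side hsin.le hα hx hv₁ hv₂ hk0 hu0 hv0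
  obtain ⟨hut, hvt⟩ := hfirst _ ⟨ht₀.le, le_rfl⟩
  rw [sidePos_cornerTime hv₂] at hut
  rw [sideVel_cornerTime] at hvt
  refine ⟨h.energyW_eq hx hv₂ hk0 hX hut hvt, ?_⟩
  have hQ := hk.pos_le
  set X := cornerPos α x₂₀ v₁₀ v₂₀ k with hXdef
  set D := cornerVel α x₂₀ v₁₀ v₂₀ k with hDdef
  set t₀ := cornerTime x₂₀ v₂₀ with ht₀def
  set b := t₀ + transitTime θ v₂₀ X with hb
  have hh : 0 < transitTime θ v₂₀ X := by unfold transitTime; positivity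
  have hsub : Icc t₀ b ⊆ Ici 0 := fun t ht => ht₀.le.trans ht.1
  have hu : ∀ t ∈ Icc t₀ b, HasDerivWithinAt u (v t) (Icc t₀ b) t :=
    fun t ht => (h.hasDeriv t (hsub ht)).mono hsub
  have hfree := norm_vel_sub_free_le hα0 hk0.le hv₂ hX.le htan.le
    (h.continuousOn_vel.mono hsub) hu (h.norm_vel_sub_le_mul hα0 hk0.le ht₀.le) hut hvt hk.corner
  obtain ⟨T, hT⟩ := exists_isCrossing hsin hcos hv₂ hX hρ0 hu hfree hut hk.corner.le_cos
    hk.corner.le_cot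
  change IsCrossing θ v₂₀ (velErr θ α x₂₀ v₁₀ v₂₀ k) t₀ X u v T at hT
  have hT0 : 0 ≤ T := ht₀.le.trans hT.lt.le
  have hρs : velErr θ α x₂₀ v₁₀ v₂₀ k ≤ v₂₀ * sin θ / 2 := hk.corner.le_sin
  have hρc : velErr θ α x₂₀ v₁₀ v₂₀ k ≤ v₂₀ * cos θ / 2 := hk.corner.le_cos
  have hvs := mul_pos hv₂ hsin
  have hvc := mul_pos hv₂ hcos
  have hv1 := abs_le.1 hT.abs_coordY₁_vel
  have hv2 := abs_le.1 hT.abs_coordY₂_vel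
  have hvel1 : 0 < coordY₁ θ (v T) := by linarith
  have hvel2 : 0 < coordY₂ θ (v T) := by linarith
  have hpos1 := hT.coordY₁_pos hsin hcos hX
  have hsecond := h.second_side hsin.le hα hk0 hT0 hpos1 hT.coordY₂_eq hvel1 hvel2
  have hY1 : ∀ t, T ≤ t →
      coordY₁ θ (u t) = oscPos α k (coordY₁ θ (u T)) (coordY₁ θ (v T)) (t - T) := by
    intro t ht; rw [hsecond t ht, coordY₁_sidePos]
  have hY2 : ∀ t, T ≤ t → coordY₂ θ (u t) = (t - T) * coordY₂ θ (v T) := by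
    intro t ht; rw [hsecond t ht, coordY₂_sidePos, hT.coordY₂_eq, zero_add]
  have hY1nonneg : ∀ t, T ≤ t → 0 ≤ coordY₁ θ (u t) := by
    intro t ht
    rcases ht.eq_or_lt with rfl | hlt
    · exact hpos1.le
    · rw [hY1 t ht]; exact (oscPos_pos hα hk0 hpos1.le hvel1 (sub_pos.2 hlt)).le
  have hfst : ∀ t ∈ Ico 0 t₀, 0 ≤ u t 0 ∧ u t 1 < 0 := by
    intro t ht
    rw [(hfirst t ⟨ht.1, ht.2.le⟩).1]
    constructor
    · rw [← coordY₁_zero_angle, coordY₁_sidePos]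
      rcases ht.1.eq_or_lt with rfl | hlt
      · simp [hα]
      · exact (oscPos_pos hα hk0 (by simp) (by simpa using hv₁) hlt).le
    · rw [← coordY₂_zero_angle, coordY₂_sidePos]
      have := (lt_div_iff₀ hv₂).1 ht.2
      simp; linarith
  refine ⟨T, hT.lt, hT.time, fun t ht => ⟨⟨fun hm => ⟨?_, ?_⟩, fun hm => ?_⟩, fun hm => ?_,
    fun hm => ⟨hY1nonneg t hm, ?_⟩⟩, fun t ht => ⟨hY1nonneg t ht, ?_⟩, fun t ht => ?_⟩
  · by_contra! hlt
    exact (hfst t ⟨ht, hlt⟩).2.not_ge hm.1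
  · by_contra! hlt
    refine hm.2.not_gt ?_
    rw [hY2 t hlt.le]
    exact mul_pos (sub_pos.2 hlt) hvel2
  · exact hT.mem_region₂ (by simp [hut]) hm
  · by_contra! hlt
    refine hm.2.not_gt ?_
    rcases lt_or_ge t t₀ with h1 | h1
    · obtain ⟨h2, h3⟩ := hfst t ⟨ht, h1⟩
      have h4 := mul_nonneg h2 hsin.le
      have h5 := mul_neg_of_neg_of_pos h3 hcos
      unfold coordY₂
      linarith
    · exact hT.coordY₂_neg t ⟨h1, hlt⟩
  · rw [hY2 t hm]
    exact mul_nonneg (sub_nonneg.2 hm) hvel2.le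
  · rw [hY1 t ht]
    refine (oscPos_le hα hpos1.le hvel1 _).trans ?_
    rw [mul_div_right_comm]
    gcongr
    have hs : 0 < √k := sqrt_pos.2 hk0
    have hξ : 0 < xi₁ α - xi₂ α := sub_pos.2 (xi₂_lt_xi₁ hα)
    -- `decayConst` is √k times the slow amplitude with y₁'(T) replaced by its bound 2v₂₀ and √k
    -- y₁(T) by its bound 1 + v₂₀.
    rw [le_div_iff₀ hs, slowAmp, decayConst, div_mul_eq_mul_div]
    gcongr
    have e : (coordY₁ θ (v T) / √k - xi₂ α * coordY₁ θ (u T)) * √k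
        = coordY₁ θ (v T) + (-xi₂ α) * (√k * coordY₁ θ (u T)) := by field_simp; ring
    rw [e]
    have hσ : √k * transitTime θ v₂₀ X ≤ 1 / 4 := by
      have h1 := hk.corner.time_small
      have h2 : 0 < √k * transitTime θ v₂₀ X := by positivity
      nlinarith
    have hle : v₂₀ * sin θ ≤ v₂₀ := mul_le_of_le_one_right hv₂.le (sin_le_one θ)
    have h1 : coordY₁ θ (v T) ≤ 2 * v₂₀ := by linarith
    have h2 : √k * coordY₁ θ (u T) ≤ 1 + v₂₀ := by
      calc √k * coordY₁ θ (u T)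
          ≤ √k * (X + (velErr θ α x₂₀ v₁₀ v₂₀ k + v₂₀) * transitTime θ v₂₀ X) := by
            gcongr
            exact (le_abs_self _).trans ((abs_coordY₁_le θ _).trans hT.pos)
        _ = √k * X + (velErr θ α x₂₀ v₁₀ v₂₀ k + v₂₀) * (√k * transitTime θ v₂₀ X) := by ring
        _ ≤ 1 + (velErr θ α x₂₀ v₁₀ v₂₀ k + v₂₀) * (1 / 4) := by gcongr
        _ ≤ 1 + v₂₀ := by linarith
    have h3 := mul_le_mul_of_nonneg_left h2 (neg_pos.2 (xi₂_neg hα)).le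
    linarith
  · have h1 : 0 ≤ t - T := sub_nonneg.2 ht
    rw [hY2 t ht, ← mul_sub, abs_mul, abs_of_nonneg h1, mul_comm]
    exact mul_le_mul_of_nonneg_right hT.abs_coordY₂_vel h1

/-! ### Asymptotics for large `k` -/

theorem tendsto_exp_mode {ξ t : ℝ} (hξ : ξ < 0) (ht : 0 < t) :
    Tendsto (fun k : ℝ => exp (ξ * t * √k)) atTop (𝓝 0) :=
  tendsto_exp_atBot.comp
    (tendsto_sqrt_atTop.const_mul_atTop_of_neg (mul_neg_of_neg_of_pos hξ ht))

theorem tendsto_sqrt_mul_exp_mode {ξ t : ℝ} (hξ : ξ < 0) (ht : 0 < t) :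
    Tendsto (fun k : ℝ => √k * exp (ξ * t * √k)) atTop (𝓝 0) := by
  have hc : 0 < -(ξ * t) := neg_pos.2 (mul_neg_of_neg_of_pos hξ ht)
  have h := ((tendsto_pow_mul_exp_neg_atTop_nhds_zero 1).comp
    (tendsto_sqrt_atTop.const_mul_atTop hc)).const_mul (-(ξ * t))⁻¹
  rw [mul_zero] at h
  refine h.congr fun k => ?_
  simp only [Function.comp, pow_one]
  rw [← mul_assoc, ← mul_assoc, inv_mul_cancel₀ hc.ne', one_mul, neg_mul, neg_neg]

theorem sqrt_mul_cornerPos {k : ℝ} (hk : 0 < k) (α x₂₀ v₁₀ v₂₀ : ℝ) :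
    √k * cornerPos α x₂₀ v₁₀ v₂₀ k = v₁₀ / (xi₁ α - xi₂ α) *
      (exp (xi₁ α * cornerTime x₂₀ v₂₀ * √k) - exp (xi₂ α * cornerTime x₂₀ v₂₀ * √k)) := by
  have : √k ≠ 0 := (sqrt_pos.2 hk).ne'
  simp only [cornerPos, oscPos, slowAmp, fastAmp, mul_zero, sub_zero, zero_sub]
  field_simp
  ring

theorem cornerVel_eq {k : ℝ} (hk : 0 < k) (α x₂₀ v₁₀ v₂₀ : ℝ) :
    cornerVel α x₂₀ v₁₀ v₂₀ k = v₁₀ / (xi₁ α - xi₂ α) *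
      (xi₁ α * exp (xi₁ α * cornerTime x₂₀ v₂₀ * √k)
        - xi₂ α * exp (xi₂ α * cornerTime x₂₀ v₂₀ * √k)) := by
  have : √k ≠ 0 := (sqrt_pos.2 hk).ne'
  simp only [cornerVel, oscVel, slowAmp, fastAmp, mul_zero, sub_zero, zero_sub]
  field_simp
  ring

theorem etaScale_sq (α x₂₀ v₂₀ k : ℝ) :
    etaScale α x₂₀ v₂₀ k ^ 2 = exp (xi₁ α * cornerTime x₂₀ v₂₀ * √k) := by
  rw [etaScale, ← exp_nat_mul]; congr 1; push_cast; ring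

section

variable {θ α x₂₀ v₁₀ v₂₀ : ℝ}

theorem tendsto_sqrt_mul_cornerPos (hα : 1 < α) (hx : x₂₀ < 0) (hv₂ : 0 < v₂₀) :
    Tendsto (fun k => √k * cornerPos α x₂₀ v₁₀ v₂₀ k) atTop (𝓝 0) := by
  have ht₀ := cornerTime_pos hx hv₂
  have h := ((tendsto_exp_mode (xi₁_neg hα) ht₀).sub (tendsto_exp_mode (xi₂_neg hα) ht₀)).const_mul
    (v₁₀ / (xi₁ α - xi₂ α))
  rw [sub_zero, mul_zero] at h
  refine h.congr' ?_
  filter_upwards [eventually_gt_atTop 0] with k hk using (sqrt_mul_cornerPos hk α x₂₀ v₁₀ v₂₀).symm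

/-- The exponential absorbs one more factor √k; this handles the term k·h in the Picard–Lindelöf
condition. -/
theorem tendsto_sqrt_mul_sqrt_mul_cornerPos (hα : 1 < α) (hx : x₂₀ < 0) (hv₂ : 0 < v₂₀) :
    Tendsto (fun k => √k * (√k * cornerPos α x₂₀ v₁₀ v₂₀ k)) atTop (𝓝 0) := by
  have ht₀ := cornerTime_pos hx hv₂
  have h := ((tendsto_sqrt_mul_exp_mode (xi₁_neg hα) ht₀).sub
    (tendsto_sqrt_mul_exp_mode (xi₂_neg hα) ht₀)).const_mul (v₁₀ / (xi₁ α - xi₂ α))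
  rw [sub_zero, mul_zero] at h
  refine h.congr' ?_
  filter_upwards [eventually_gt_atTop 0] with k hk
  rw [sqrt_mul_cornerPos hk]; ring

theorem tendsto_cornerPos (hα : 1 < α) (hx : x₂₀ < 0) (hv₂ : 0 < v₂₀) :
    Tendsto (cornerPos α x₂₀ v₁₀ v₂₀) atTop (𝓝 0) := by
  have h := (tendsto_inv_atTop_zero.comp tendsto_sqrt_atTop).mul
    (tendsto_sqrt_mul_cornerPos (v₁₀ := v₁₀) hα hx hv₂)
  rw [mul_zero] at h
  refine h.congr' ?_
  filter_upwards [eventually_gt_atTop 0] with k hk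
  have : √k ≠ 0 := (sqrt_pos.2 hk).ne'
  simp only [Function.comp]
  field_simp

theorem tendsto_cornerVel (hα : 1 < α) (hx : x₂₀ < 0) (hv₂ : 0 < v₂₀) :
    Tendsto (cornerVel α x₂₀ v₁₀ v₂₀) atTop (𝓝 0) := by
  have ht₀ := cornerTime_pos hx hv₂
  have h := (((tendsto_exp_mode (xi₁_neg hα) ht₀).const_mul (xi₁ α)).sub
    ((tendsto_exp_mode (xi₂_neg hα) ht₀).const_mul (xi₂ α))).const_mul (v₁₀ / (xi₁ α - xi₂ α))
  rw [mul_zero, mul_zero, sub_zero, mul_zero] at h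
  refine h.congr' ?_
  filter_upwards [eventually_gt_atTop 0] with k hk using (cornerVel_eq hk α x₂₀ v₁₀ v₂₀).symm

theorem tendsto_sqrt_mul_transitTime (hα : 1 < α) (hx : x₂₀ < 0) (hv₂ : 0 < v₂₀) :
    Tendsto (fun k => √k * transitTime θ v₂₀ (cornerPos α x₂₀ v₁₀ v₂₀ k)) atTop (𝓝 0) := by
  have h := (tendsto_sqrt_mul_cornerPos (v₁₀ := v₁₀) hα hx hv₂).const_mul (4 * tan θ / v₂₀)
  rw [mul_zero] at h
  exact h.congr fun k => by unfold transitTime; ring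

theorem tendsto_velErr (hα : 1 < α) (hx : x₂₀ < 0) (hv₂ : 0 < v₂₀) :
    Tendsto (velErr θ α x₂₀ v₁₀ v₂₀) atTop (𝓝 0) := by
  have hσ := tendsto_sqrt_mul_transitTime (θ := θ) (v₁₀ := v₁₀) hα hx hv₂
  have hQ := tendsto_sqrt_mul_cornerPos (v₁₀ := v₁₀) hα hx hv₂
  have hD := (tendsto_cornerVel (v₁₀ := v₁₀) hα hx hv₂).abs
  have h := (hσ.mul (((hσ.const_add (2 * α)).mul
    (((hD.add_const v₂₀).add (hσ.mul hQ)).const_mul 2)).add hQ)).add hD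
  simp only [mul_zero, zero_mul, add_zero, abs_zero] at h
  exact h

theorem eventually_isStiff (hsin : 0 < sin θ) (hcos : 0 < cos θ) (hα : 1 < α) (hx : x₂₀ < 0)
    (hv₂ : 0 < v₂₀) : ∀ᶠ k in atTop, IsStiff θ α x₂₀ v₁₀ v₂₀ k := by
  have hσ := tendsto_sqrt_mul_transitTime (θ := θ) (v₁₀ := v₁₀) hα hx hv₂
  have hQ := tendsto_sqrt_mul_cornerPos (v₁₀ := v₁₀) hα hx hv₂
  have hQ' := tendsto_sqrt_mul_sqrt_mul_cornerPos (v₁₀ := v₁₀) hα hx hv₂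
  have hX := tendsto_cornerPos (v₁₀ := v₁₀) hα hx hv₂
  have hD := (tendsto_cornerVel (v₁₀ := v₁₀) hα hx hv₂).abs
  have hρ := tendsto_velErr (θ := θ) (v₁₀ := v₁₀) hα hx hv₂
  have e1 := hσ.mul (hσ.const_add (2 * α))
  rw [zero_mul] at e1
  have e2 := hρ.mul_const (4 * tan θ / v₂₀)
  rw [zero_mul] at e2
  have e3 : Tendsto (fun k => ((|cornerVel α x₂₀ v₁₀ v₂₀ k| + v₂₀ + 1) + (2 * α * √k *
      (|cornerVel α x₂₀ v₁₀ v₂₀ k| + v₂₀ + 1) + k * (cornerPos α x₂₀ v₁₀ v₂₀ k + 1)))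
      * transitTime θ v₂₀ (cornerPos α x₂₀ v₁₀ v₂₀ k)) atTop (𝓝 0) := by
    have hV := (hD.add_const v₂₀).add_const 1
    have h := (((hV.mul hX).add ((hV.const_mul (2 * α)).mul hQ)).add
      (hQ'.mul (hX.add_const 1))).const_mul (4 * tan θ / v₂₀)
    simp only [mul_zero, zero_mul, add_zero] at h
    refine h.congr' ?_
    filter_upwards [eventually_gt_atTop 0] with k hk
    have hs : √k * √k = k := mul_self_sqrt hk.le
    unfold transitTime
    linear_combination (4 * tan θ / v₂₀ * cornerPos α x₂₀ v₁₀ v₂₀ k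
      * (cornerPos α x₂₀ v₁₀ v₂₀ k + 1)) * hs
  filter_upwards [eventually_gt_atTop 0, e1.eventually_le_const (by norm_num : (0 : ℝ) < 1 / 2),
    hρ.eventually_le_const (by positivity : 0 < v₂₀ * cos θ / 2),
    hρ.eventually_le_const (by positivity : 0 < v₂₀ * sin θ / 2),
    e2.eventually_le_const (by norm_num : (0 : ℝ) < 1 / 2), hQ.eventually_le_const one_pos,
    e3.eventually_le_const one_pos] with k h0 h1 h2 h3 h4 h5 h6
  exact ⟨h0, ⟨h1, h2, h3, h4⟩, h5, h6⟩

/-- The slow mode at the corner time is exactly η², and the fast mode is exponentially smaller. -/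
theorem tendsto_sqrt_mul_cornerPos_div (hα : 1 < α) (hx : x₂₀ < 0) (hv₂ : 0 < v₂₀) :
    Tendsto (fun k => √k * cornerPos α x₂₀ v₁₀ v₂₀ k / etaScale α x₂₀ v₂₀ k ^ 2) atTop
      (𝓝 (v₁₀ / (xi₁ α - xi₂ α))) := by
  have ht₀ := cornerTime_pos hx hv₂
  have h := ((tendsto_exp_mode (sub_neg.2 (xi₂_lt_xi₁ hα)) ht₀).const_sub 1).const_mul
    (v₁₀ / (xi₁ α - xi₂ α))
  rw [sub_zero, mul_one] at h
  refine h.congr' ?_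
  filter_upwards [eventually_gt_atTop 0] with k hk
  rw [sqrt_mul_cornerPos hk, etaScale_sq, mul_div_assoc, sub_div, div_self (exp_ne_zero _),
    ← exp_sub]
  ring_nf

theorem sqrt_constE (hα : 1 < α) (hv₁ : 0 < v₁₀) (hv₂ : 0 < v₂₀) :
    √(constE α v₁₀ v₂₀) = v₁₀ / (xi₁ α - xi₂ α) * v₂₀ := by
  have hΔ := sqrt_disc_pos hα
  have hsq : √(α ^ 2 - 1) ^ 2 = α ^ 2 - 1 := sq_sqrt (by nlinarith)
  rw [xi₁_sub_xi₂, sqrt_eq_iff_mul_self_eq_of_pos (by positivity), constE]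
  have hΔ' : α ^ 2 - 1 ≠ 0 := (sqrt_pos.1 hΔ).ne'
  field_simp
  rw [hsq]
  ring

/-- The limit of the scaled energy. -/
theorem tendsto_scaled_energy (hα : 1 < α) (hx : x₂₀ < 0) (hv₁ : 0 < v₁₀) (hv₂ : 0 < v₂₀) :
    Tendsto (fun k => ((cornerVel α x₂₀ v₁₀ v₂₀ k / etaScale α x₂₀ v₂₀ k) ^ 2
      + constE α v₁₀ v₂₀ / (√k * cornerPos α x₂₀ v₁₀ v₂₀ k / etaScale α x₂₀ v₂₀ k) ^ 2)
      * etaScale α x₂₀ v₂₀ k ^ 2) atTop (𝓝 (v₂₀ ^ 2)) := by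
  have hξ : 0 < xi₁ α - xi₂ α := sub_pos.2 (xi₂_lt_xi₁ hα)
  have hc : 0 < v₁₀ / (xi₁ α - xi₂ α) := div_pos hv₁ hξ
  have hE : constE α v₁₀ v₂₀ = (v₁₀ / (xi₁ α - xi₂ α) * v₂₀) ^ 2 := by
    rw [← sqrt_constE hα hv₁ hv₂, sq_sqrt]
    have : 0 < α ^ 2 - 1 := by nlinarith
    unfold constE; positivity
  -- After multiplication by η² the kinetic term is D² → 0 and the other one is E/(√k X/η²)² → E/c²
  -- = v₂₀².
  have h := ((tendsto_cornerVel (v₁₀ := v₁₀) hα hx hv₂).pow 2).add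
    (tendsto_const_nhds (x := constE α v₁₀ v₂₀) |>.div
      ((tendsto_sqrt_mul_cornerPos_div (v₁₀ := v₁₀) hα hx hv₂).pow 2) (pow_ne_zero 2 hc.ne'))
  have e : (0 : ℝ) ^ 2 + constE α v₁₀ v₂₀ / (v₁₀ / (xi₁ α - xi₂ α)) ^ 2 = v₂₀ ^ 2 := by
    rw [hE]; field_simp; ring
  rw [e] at h
  refine h.congr' ?_
  filter_upwards [eventually_gt_atTop 0] with k hk
  have hη : etaScale α x₂₀ v₂₀ k ≠ 0 := exp_ne_zero _
  have hX := (cornerPos_pos hα hx hv₁ hv₂ hk).ne'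
  have : √k ≠ 0 := (sqrt_pos.2 hk).ne'
  simp only [Pi.div_apply]
  field_simp

end

/-- The limit of the scaled duration of the passage. -/
theorem tendsto_of_abs_sub_le_mul {l : Filter ℝ} {r q ρ : ℝ → ℝ} {c s d : ℝ} (hd : 0 < d)
    (hq : Tendsto q l (𝓝 c)) (hρ : Tendsto ρ l (𝓝 0))
    (h : ∀ᶠ k in l, |q k * s - r k * d| ≤ ρ k * r k) : Tendsto r l (𝓝 (c * s / d)) := by
  -- Solving the two inequalities for r squeezes it between qs/(d + ρ) and qs/(d - ρ); no sign of r
  -- is needed.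
  have h1 : Tendsto (fun k => q k * s / (d + ρ k)) l (𝓝 (c * s / d)) := by
    have := (hq.mul_const s).div (hρ.const_add d) (by simpa using hd.ne')
    rwa [add_zero] at this
  have h2 : Tendsto (fun k => q k * s / (d - ρ k)) l (𝓝 (c * s / d)) := by
    have := (hq.mul_const s).div (hρ.const_sub d) (by simpa using hd.ne')
    rwa [sub_zero] at this
  refine tendsto_of_tendsto_of_tendsto_of_le_of_le' h1 h2 ?_ ?_
  · filter_upwards [h, hρ.eventually_const_lt (neg_lt_zero.2 hd)] with k hk hk2
    rw [div_le_iff₀ (by linarith)]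
    linarith [(abs_le.1 hk).2]
  · filter_upwards [h, hρ.eventually_lt_const hd] with k hk hk2
    rw [le_div_iff₀ (by linarith)]
    linarith [(abs_le.1 hk).1]

end

/-! ### Assembly of the theorem -/

theorem mainTheorem3 (θ α x₂₀ v₁₀ v₂₀ : ℝ) (hθ₀ : 0 < θ) (hθ : θ < π / 2) (hα : 1 < α)
    (hx : x₂₀ < 0) (hv₁ : 0 < v₁₀) (hv₂ : 0 < v₂₀) :
    (∀ᶠ k in atTop, ∃ u : ℝ → Plane, IsPenalizedMotion θ α x₂₀ v₁₀ v₂₀ k u) ∧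
    ∃ C : ℝ, ∀ u : ℝ → ℝ → Plane,
      (∀ᶠ k in atTop, IsPenalizedMotion θ α x₂₀ v₁₀ v₂₀ k (u k)) →
      ∃ τbar tbar : ℝ → ℝ,
        (∀ k, tbar k = cornerTime x₂₀ v₂₀ + τbar k / √k) ∧
        -- the point is in the vertex region exactly until `tbar`, in the third region afterwards
        (∀ᶠ k in atTop, ∀ t, 0 ≤ t →
          (u k t ∈ region₂ θ ↔ cornerTime x₂₀ v₂₀ ≤ t ∧ t ≤ tbar k) ∧
          (u k t ∈ region₃ θ ↔ tbar k ≤ t)) ∧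
        (τbar ~[atTop] fun k => tan θ * √(constE α v₁₀ v₂₀) / energyW α x₂₀ v₁₀ v₂₀ k (u k)) ∧
        (τbar =O[atTop] fun k => etaScale α x₂₀ v₂₀ k ^ 2) ∧
        (∀ᶠ k in atTop, ∀ t, tbar k ≤ t →
          0 ≤ coordY₁ θ (u k t) ∧
          coordY₁ θ (u k t) ≤ C * exp (xi₁ α * (t - tbar k) * √k) / √k) ∧
        -- the equivalence of `y₂` holds uniformly in `t`
        (∀ ε : ℝ, 0 < ε → ∀ᶠ k in atTop, ∀ t, tbar k ≤ t →
          |coordY₂ θ (u k t) - (t - tbar k) * v₂₀ * cos θ| ≤ ε * ((t - tbar k) * v₂₀ * cos θ)) := by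
  have hsin : 0 < sin θ := sin_pos_of_pos_of_lt_pi hθ₀ (by linarith [pi_pos])
  have hcos : 0 < cos θ := cos_pos_of_mem_Ioo ⟨by linarith [pi_pos], hθ⟩
  have hstiff := eventually_isStiff (v₁₀ := v₁₀) hsin hcos hα hx hv₂
  refine ⟨hstiff.mono fun k hk => hk.exists_isPenalizedMotion hsin hcos hα hx hv₁ hv₂,
    decayConst α v₂₀, fun u hu => ?_⟩
  have hpass := (hstiff.and hu).mono fun k hk =>
    hk.1.passage hsin hcos hα hx hv₁ hv₂ hk.2
  obtain ⟨T, hT⟩ := (hpass.mono fun k hk => hk.2).choice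
  have hvc : 0 < v₂₀ * cos θ := mul_pos hv₂ hcos
  -- The prescribed form of `tbar` must hold for every k, including k ≤ 0 where √k = 0, so `tbar`
  -- and T are only identified eventually.
  have hbar : ∀ᶠ k : ℝ in atTop, cornerTime x₂₀ v₂₀
      + √k * (T k - cornerTime x₂₀ v₂₀) / √k = T k := by
    filter_upwards [eventually_gt_atTop 0] with k hk
    have : √k ≠ 0 := (sqrt_pos.2 hk).ne'
    field_simp; ring
  have hη : ∀ k, 0 < etaScale α x₂₀ v₂₀ k ^ 2 := fun k => pow_pos (exp_pos _) 2
  have hξ : 0 < xi₁ α - xi₂ α := sub_pos.2 (xi₂_lt_xi₁ hα)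
  have hlim : Tendsto (fun k => √k * (T k - cornerTime x₂₀ v₂₀) / etaScale α x₂₀ v₂₀ k ^ 2) atTop
      (𝓝 (v₁₀ / (xi₁ α - xi₂ α) * sin θ / (v₂₀ * cos θ))) := by
    refine tendsto_of_abs_sub_le_mul hvc (tendsto_sqrt_mul_cornerPos_div hα hx hv₂)
      (tendsto_velErr (θ := θ) (v₁₀ := v₁₀) hα hx hv₂) ?_
    filter_upwards [hT] with k hk
    have h1 : 0 ≤ √k / etaScale α x₂₀ v₂₀ k ^ 2 := by have := hη k; positivity
    have h2 := mul_le_mul_of_nonneg_left hk.2.1 h1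
    rw [← abs_of_nonneg h1, ← abs_mul, abs_of_nonneg h1] at h2
    refine le_trans (le_of_eq ?_) (h2.trans (le_of_eq ?_))
    · congr 1; ring
    · ring
  -- Same normalization and same nonzero limit as in `hlim`: the equivalence in (ii) is the quotient
  -- of the two limits.
  have hlim2 : Tendsto (fun k => tan θ * √(constE α v₁₀ v₂₀) / energyW α x₂₀ v₁₀ v₂₀ k (u k)
      / etaScale α x₂₀ v₂₀ k ^ 2) atTop
      (𝓝 (v₁₀ / (xi₁ α - xi₂ α) * sin θ / (v₂₀ * cos θ))) := by
    have h := tendsto_const_nhds (x := tan θ * √(constE α v₁₀ v₂₀)) |>.div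
      (tendsto_scaled_energy hα hx hv₁ hv₂) (pow_ne_zero 2 hv₂.ne')
    have e : tan θ * √(constE α v₁₀ v₂₀) / v₂₀ ^ 2
        = v₁₀ / (xi₁ α - xi₂ α) * sin θ / (v₂₀ * cos θ) := by
      rw [sqrt_constE hα hv₁ hv₂, tan_eq_sin_div_cos]; field_simp
    rw [e] at h
    refine h.congr' ?_
    filter_upwards [hpass] with k hk
    rw [hk.1, div_div, Pi.div_apply]
  have hL : v₁₀ / (xi₁ α - xi₂ α) * sin θ / (v₂₀ * cos θ) ≠ 0 := by positivity
  refine ⟨fun k => √k * (T k - cornerTime x₂₀ v₂₀),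
    fun k => cornerTime x₂₀ v₂₀ + √k * (T k - cornerTime x₂₀ v₂₀) / √k, fun k => rfl,
    ?_, ?_, ?_, ?_, fun ε hε => ?_⟩
  · filter_upwards [hT, hbar] with k hk hb
    rw [hb]; exact hk.2.2.1
  · refine isEquivalent_of_tendsto_one ?_
    have h := hlim.div hlim2 hL
    rw [div_self hL] at h
    refine h.congr fun k => ?_
    exact div_div_div_cancel_right₀ (hη k).ne' _ _
  · exact isBigO_of_div_tendsto_nhds (Eventually.of_forall fun k h0 => absurd h0 (hη k).ne') _ hlim
  · filter_upwards [hT, hbar] with k hk hb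
    rw [hb]; exact hk.2.2.2.1
  · have hρ := (tendsto_velErr (θ := θ) (v₁₀ := v₁₀) hα hx hv₂).eventually_le_const
      (mul_pos hε hvc)
    filter_upwards [hT, hbar, hρ] with k hk hb hρ t ht
    rw [hb] at ht ⊢
    have h1 := hk.2.2.2.2 t ht
    rw [mul_assoc]
    refine h1.trans ?_
    have := mul_le_mul_of_nonneg_right hρ (sub_nonneg.2 ht)
    linarith
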